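/- Let $k\in\{\mathbb R,\mathbb C\}$ and let $(\mathcal A,\mathcal H,D;J)$ be a real spectral triple: $\mathcal A$ is a unital involutive $k$-algebra with a unital $*$-representation by bounded operators on the complex Hilbert space $\mathcal H$, $D$ is a self-adjoint operator with compact resolvent, every $a\in\mathcal A$ preserves $\mathrm{Dom}(D)$ with $[D,a]$ bounded, and $J$ is an antiunitary operator with $J^2=\epsilon_J$, $JDJ^{-1}=\epsilon D$ for signs $\epsilon_J,\epsilon\in\{\pm1\}$, and $[a,JbJ^{-1}]=0$ for all $a,b\in\mathcal A$. The right action of $\mathcal A$ on $\mathcal H$ is $\xi a=Ja^*J^{-1}\xi$. Write $\hat a=JaJ^{-1}$. The first-order condition for $(\mathcal A,\mathcal H,D;J)$ is $[[D,a],JbJ^{-1}]=0$ for all $a,b\in\mathcal A$. Let $\Omega^1(\mathcal A)=\ker(\mathcal A\otimes_k\mathcal A\to\mathcal A)$ be the bimodule of universal one-forms, with $\delta(b)=1\otimes b-b\otimes1$, and let $\Omega^1_D(\mathcal A)=\{\sum_j a_j[D,b_j]\}$, a bimodule of bounded operators on $\mathcal H$. Let $\mathcal E$ be a finitely generated projective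 right $\mathcal A$-module, $\overline{\mathcal E}$ its conjugate left module ($a\bar v=\overline{va^*}$), and $\nabla:\mathcal E\to\mathcal E\otimes_{\mathcal A}\Omega^1(\mathcal A)$ a universal connection, $\nabla(va)=\nabla(v)a+v\otimes\delta(a)$. On $\mathcal H'=\mathcal E\otimes_{\mathcal A}\mathcal H\otimes_{\mathcal A}\overline{\mathcal E}$ let $\mathrm{End}_{\mathcal A}(\mathcal E)$ act on the first factor, let $J'(v_1\otimes\xi\otimes\bar v_2)=v_2\otimes J\xi\otimes\bar v_1$, and let $D'=(1\otimes_\nabla D)\otimes_{\overline\nabla}1$. Explicitly, with $\nabla v=\sum_i w_i\otimes a_i\delta(b_i)$, $$(1\otimes_\nabla D)(v\otimes\xi)=\sum_i w_i\otimes a_i[D,b_i]\xi+v\otimes D\xi\qquad(\xi\in\mathrm{Dom}(D)),$$ and, with $T=1\otimes_\nabla D$ and $\hat a$ acting on $\mathcal E\otimes_{\mathcal A}\mathcal H$ by $1\otimes\hat a$, $$D'(x\otimes\bar v)=Tx\otimes\bar v+\sum_i\hat a_i[T,\hat b_i]x\otimes\bar w_i\qquad(x\in\mathrm{Dom}(T)).$$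 Suppose that $(\mathcal A,\mathcal H,D;J)$ satisfies the first-order condition. Then $D'$ is a well-defined linear operator, with domain the span of the $v_1\otimes\xi\otimes\bar v_2$ with $\xi\in\mathrm{Dom}(D)$; the algebra $\mathrm{End}_{\mathcal A}(\mathcal E)$ preserves this domain, $J'^2=\epsilon_J$, $J'D'J'^{-1}=\epsilon D'$, $[\varphi,J'\psi J'^{-1}]=0$ for all $\varphi,\psi\in\mathrm{End}_{\mathcal A}(\mathcal E)$; and $(\mathrm{End}_{\mathcal A}(\mathcal E),\mathcal H',D';J')$ satisfies the first-order condition $$[[D',\varphi],J'\psi J'^{-1}]=0\qquad(\varphi,\psi\in\mathrm{End}_{\mathcal A}(\mathcal E)).$$ Moreover $D'$ is the usual inner fluctuation: representing $\nabla$ by $a\,\delta(b)\mapsto a[D,b]$ gives a connection $\nabla^D:\mathcal E\to\mathcal E\otimes_{\mathcal A}\Omega^1_D(\mathcal A)$, $\nabla^D(va)=\nabla^D(v)a+v\otimes[D,a]$, and $D'$ is the operator, with the domain above, given by $$D'(v_1\otimes\xi\otimes\bar v_2)=\sum_i w_i\otimes\omega_i\xi\otimes\bar v_2+v_1\otimes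 D\xi\otimes\bar v_2+\sum_j v_1\otimes\epsilon J\eta_jJ^{-1}\xi\otimes\bar u_j$$ whenever $\nabla^Dv_1=\sum_i w_i\otimes\omega_i$ and $\nabla^Dv_2=\sum_j u_j\otimes\eta_j$ with $\omega_i,\eta_j\in\Omega^1_D(\mathcal A)$. -/

import Mathlib

open scoped TensorProduct
open MulOpposite

noncomputable section

namespace NCG

/-! ### Balanced tensor products -/

section Balanced

/-- The relations `v a ⊗ n = v ⊗ a n`, for a right `A`-module `E` and an `R`-module `N` on which
`A` acts on the left by `R`-linear maps through `ρ`. -/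
def balRel {A R N : Type*} [Ring A] [Ring R] [AddCommGroup N] [Module R N]
    (ρ : A →+* Module.End R N) (E : Type*) [AddCommGroup E] [Module Aᵐᵒᵖ E] :
    Submodule R (N ⊗[ℤ] E) :=
  Submodule.span R {t | ∃ (v : E) (a : A) (n : N), t = ρ a n ⊗ₜ[ℤ] v - n ⊗ₜ[ℤ] (op a • v)}

/-- The tensor product `E ⊗_A N` of a right `A`-module `E` with an `R`-module `N` on which `A`
acts on the left through `ρ`. It keeps the `R`-module structure of `N` (`R = ℂ` for Hilbert spaces,
`R = Aᵐᵒᵖ` for bimodules of one-forms).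

Tensor products `N ⊗_A Ē` with the conjugate left module `Ē` (`a v̄ = conj (v a*)`) are instances of
the same construction. If `A` acts on `N` on the right, put `σ a n = n a*`. Then `σ` is a ring
homomorphism, and the relations `n a* ⊗ v̄ = n ⊗ a* v̄ = n ⊗ conj (v a)` defining `N ⊗_A Ē` are
exactly the relations of `BalTensor σ E`. For the right action `ξ a = J a* J⁻¹ ξ` given by a real
structure this `σ` is `σ a = J a J⁻¹`. -/
def BalTensor {A R N : Type*} [Ring A] [Ring R] [AddCommGroup N] [Module R N]
    (ρ : A →+* Module.End R N) (E : Type*) [AddCommGroup E] [Module Aᵐᵒᵖ E] : Type _ :=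
  (N ⊗[ℤ] E) ⧸ balRel ρ E

variable {A R N : Type*} [Ring A] [Ring R] [AddCommGroup N] [Module R N]
  (ρ : A →+* Module.End R N) {E : Type*} [AddCommGroup E] [Module Aᵐᵒᵖ E]

instance : AddCommGroup (BalTensor ρ E) :=
  inferInstanceAs (AddCommGroup ((N ⊗[ℤ] E) ⧸ balRel ρ E))

instance : Module R (BalTensor ρ E) :=
  inferInstanceAs (Module R ((N ⊗[ℤ] E) ⧸ balRel ρ E))

variable (E) in
/-- The quotient map onto `E ⊗_A N`. -/
def BalTensor.mk : N ⊗[ℤ] E →ₗ[R] BalTensor ρ E := (balRel ρ E).mkQ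

/-- The elementary tensor `v ⊗ n` in `E ⊗_A N`. -/
def tmul (v : E) (n : N) : BalTensor ρ E := BalTensor.mk ρ E (n ⊗ₜ[ℤ] v)

/-- `v ⊗ n`, as an additive map in `v` with values in the `R`-linear maps of `n`. -/
def tmulHom : E →+ (N →ₗ[R] BalTensor ρ E) where
  toFun v :=
    { toFun := fun n => tmul ρ v n
      map_add' := fun m n => by simp [tmul, TensorProduct.add_tmul]
      map_smul' := fun r n => by
        simp only [tmul, RingHom.id_apply, ← map_smul, TensorProduct.smul_tmul'] }
  map_zero' := by ext n; simp [tmul]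
  map_add' v w := by ext n; simp [tmul, TensorProduct.tmul_add]

@[simp] theorem tmulHom_apply (v : E) (n : N) : tmulHom ρ v n = tmul ρ v n := rfl

theorem tmul_balanced (v : E) (a : A) (n : N) : tmul ρ (op a • v) n = tmul ρ v (ρ a n) := by
  symm
  rw [tmul, tmul, ← sub_eq_zero, ← map_sub]
  exact (Submodule.Quotient.mk_eq_zero _).2 (Submodule.subset_span ⟨v, a, n, rfl⟩)

theorem BalTensor.induction {p : BalTensor ρ E → Prop} (h0 : p 0)
    (ht : ∀ v n, p (tmul ρ v n)) (ha : ∀ x y, p x → p y → p (x + y)) (x : BalTensor ρ E) : p x := by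
  obtain ⟨t, rfl⟩ : ∃ t, BalTensor.mk ρ E t = x := (balRel ρ E).mkQ_surjective x
  induction t using TensorProduct.induction_on with
  | zero => simpa using h0
  | tmul n v => exact ht v n
  | add s t hs ht => rw [map_add]; exact ha _ _ hs ht

variable {R' P : Type*} [Ring R'] [AddCommGroup P] [Module R' P] {τ : R →+* R'}

/-- The semilinear map on `N ⊗ E` given by a biadditive map that is semilinear in `N`. -/
def liftPre (f : E →+ (N →ₛₗ[τ] P)) : N ⊗[ℤ] E →ₛₗ[τ] P :=
  let g : N ⊗[ℤ] E →+ P := TensorProduct.liftAddHom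
    (AddMonoidHom.flip ((LinearMap.toAddMonoidHom' : (N →ₛₗ[τ] P) →+ (N →+ P)).comp f))
    (fun r n v => by simp)
  { toFun := g
    map_add' := map_add g
    map_smul' := fun r t => by
      induction t using TensorProduct.induction_on with
      | zero => simp
      | tmul n v => simp [g, TensorProduct.smul_tmul']
      | add s t hs ht => rw [smul_add, map_add, hs, ht, map_add, smul_add] }

theorem liftPre_tmul (f : E →+ (N →ₛₗ[τ] P)) (n : N) (v : E) :
    liftPre f (n ⊗ₜ[ℤ] v) = f v n := rfl

/-- Balanced maps factor through the tensor product `E ⊗_A N`. -/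
def BalTensor.lift (f : E →+ (N →ₛₗ[τ] P)) (hf : ∀ v a n, f v (ρ a n) = f (op a • v) n) :
    BalTensor ρ E →ₛₗ[τ] P :=
  (balRel ρ E).liftQ (liftPre f) (by
    refine Submodule.span_le.2 ?_
    rintro _ ⟨v, a, n, rfl⟩
    rw [SetLike.mem_coe, LinearMap.mem_ker, map_sub, liftPre_tmul, liftPre_tmul, hf, sub_self])

theorem BalTensor.lift_tmul (f : E →+ (N →ₛₗ[τ] P))
    (hf : ∀ v a n, f v (ρ a n) = f (op a • v) n) (v : E) (n : N) :
    BalTensor.lift ρ f hf (tmul ρ v n) = f v n := by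
  exact liftPre_tmul f n v

theorem BalTensor.hom_ext {f g : BalTensor ρ E →ₛₗ[τ] P}
    (h : ∀ v n, f (tmul ρ v n) = g (tmul ρ v n)) : f = g :=
  LinearMap.ext fun x => by
    induction x using BalTensor.induction ρ with
    | h0 => rw [map_zero, map_zero]
    | ht v n => exact h v n
    | ha x y hx hy => rw [map_add, map_add, hx, hy]

/-- The operator `v ⊗ n ↦ φ v ⊗ n` on `E ⊗_A N`. -/
def endMap (φ : Module.End Aᵐᵒᵖ E) : BalTensor ρ E →ₗ[R] BalTensor ρ E :=
  BalTensor.lift ρ ((tmulHom ρ).comp φ.toAddMonoidHom) (fun v a n => by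
    change tmul ρ (φ v) (ρ a n) = tmul ρ (φ (op a • v)) n
    rw [map_smul, tmul_balanced])

theorem endMap_tmul (φ : Module.End Aᵐᵒᵖ E) (v : E) (n : N) :
    endMap ρ φ (tmul ρ v n) = tmul ρ (φ v) n := rfl

variable (E) in
/-- The action of `End_A(E)` on `E ⊗_A N`: `φ (v ⊗ n) = φ v ⊗ n`. -/
def endAction : Module.End Aᵐᵒᵖ E →+* Module.End R (BalTensor ρ E) where
  toFun φ := endMap ρ φ
  map_one' := BalTensor.hom_ext ρ fun v n => endMap_tmul ρ 1 v n
  map_mul' φ ψ := BalTensor.hom_ext ρ fun v n => by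
    rw [Module.End.mul_apply, endMap_tmul, endMap_tmul, endMap_tmul]; rfl
  map_zero' := BalTensor.hom_ext ρ fun v n => by
    rw [endMap_tmul]
    exact LinearMap.congr_fun (map_zero (tmulHom ρ)) n
  map_add' φ ψ := BalTensor.hom_ext ρ fun v n => by
    rw [LinearMap.add_apply, endMap_tmul, endMap_tmul, endMap_tmul]
    exact LinearMap.congr_fun (map_add (tmulHom ρ) (φ v) (ψ v)) n

theorem endAction_tmul (φ : Module.End Aᵐᵒᵖ E) (v : E) (n : N) :
    endAction ρ E φ (tmul ρ v n) = tmul ρ (φ v) n := rfl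

variable (E) in
/-- The operator `v ⊗ n ↦ v ⊗ g n` on `E ⊗_A N`, for `g` commuting with the action of `A`. -/
def rightMap (g : Module.End R N) (h : ∀ a, Commute (ρ a) g) :
    BalTensor ρ E →ₗ[R] BalTensor ρ E :=
  BalTensor.lift ρ
    { toFun := fun v => (tmulHom ρ v).comp g
      map_zero' := by rw [map_zero, LinearMap.zero_comp]
      map_add' := fun v w => by rw [map_add, LinearMap.add_comp] } (fun v a n => by
      change tmul ρ v (g (ρ a n)) = tmul ρ (op a • v) (g n)
      rw [tmul_balanced]
      exact congrArg (tmul ρ v) (LinearMap.congr_fun (h a).eq n).symm)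

theorem rightMap_tmul (g : Module.End R N) (h : ∀ a, Commute (ρ a) g) (v : E) (n : N) :
    rightMap ρ E g h (tmul ρ v n) = tmul ρ v (g n) := rfl

variable {B : Type*} [Ring B]

variable (E) in
/-- If `B` acts on `N` through `σ`, commuting with `ρ`, then `B` acts on `E ⊗_A N` by
`b (v ⊗ n) = v ⊗ b n`. -/
def inducedAction (σ : B →+* Module.End R N) (h : ∀ a b, Commute (ρ a) (σ b)) :
    B →+* Module.End R (BalTensor ρ E) where
  toFun b := rightMap ρ E (σ b) (fun a => h a b)
  map_one' := BalTensor.hom_ext ρ fun v n => by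
    rw [rightMap_tmul]
    exact congrArg (tmul ρ v) (LinearMap.congr_fun (map_one σ) n)
  map_mul' b c := BalTensor.hom_ext ρ fun v n => by
    rw [Module.End.mul_apply, rightMap_tmul, rightMap_tmul, rightMap_tmul]
    exact congrArg (tmul ρ v) (LinearMap.congr_fun (map_mul σ b c) n)
  map_zero' := BalTensor.hom_ext ρ fun v n => by
    rw [rightMap_tmul]
    exact (congrArg (tmulHom ρ v) (LinearMap.congr_fun (map_zero σ) n)).trans (map_zero _)
  map_add' b c := BalTensor.hom_ext ρ fun v n => by
    rw [LinearMap.add_apply, rightMap_tmul, rightMap_tmul, rightMap_tmul]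
    exact (congrArg (tmulHom ρ v) (LinearMap.congr_fun (map_add σ b c) n)).trans (map_add _ _ _)

theorem inducedAction_tmul (σ : B →+* Module.End R N) (h : ∀ a b, Commute (ρ a) (σ b))
    (b : B) (v : E) (n : N) :
    inducedAction ρ E σ h b (tmul ρ v n) = tmul ρ v (σ b n) := rfl

end Balanced

/-! ### Real structures and the first-order condition -/

section RealStructure

variable {B N : Type*} [Ring B] [AddCommGroup N] [Module ℂ N]

/-- The representation `b ↦ J b J⁻¹`. -/
def conjRep (J : N ≃ₛₗ[starRingEnd ℂ] N) (ρ : B →+* Module.End ℂ N) : B →+* Module.End ℂ N where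
  toFun b :=
    { toFun := fun x => J (ρ b (J.symm x))
      map_add' := by simp
      map_smul' := fun c x => by simp [LinearEquiv.map_smulₛₗ] }
  map_one' := by ext; simp
  map_mul' b c := by ext; simp
  map_zero' := by ext; simp
  map_add' b c := by ext; simp

@[simp] theorem conjRep_apply (J : N ≃ₛₗ[starRingEnd ℂ] N) (ρ : B →+* Module.End ℂ N) (b : B)
    (x : N) : conjRep J ρ b x = J (ρ b (J.symm x)) := rfl

/-- The commutator `[D, g]`, defined on the domain of `D`, for `g` preserving that domain. -/
def commutator (D : N →ₗ.[ℂ] N) (g : Module.End ℂ N) (hg : ∀ x ∈ D.domain, g x ∈ D.domain) :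
    D.domain →ₗ[ℂ] N :=
  D.toFun ∘ₗ (g ∘ₗ D.domain.subtype).codRestrict D.domain (fun x => hg x x.2) - g ∘ₗ D.toFun

theorem commutator_apply (D : N →ₗ.[ℂ] N) (g : Module.End ℂ N)
    (hg : ∀ x ∈ D.domain, g x ∈ D.domain) (x : D.domain) :
    commutator D g hg x = D ⟨g x, hg x x.2⟩ - g (D x) := rfl

/-- The algebraic part of the axioms of a real spectral triple with signs `J² = εJ`,
`J D J⁻¹ = ε D`: the algebra preserves the domain of `D` and commutes with `J B J⁻¹`. -/
structure IsRealStructure (ρ : B →+* Module.End ℂ N) (D : N →ₗ.[ℂ] N)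
    (J : N ≃ₛₗ[starRingEnd ℂ] N) (εJ ε : ℤˣ) : Prop where
  dom : ∀ b, ∀ x ∈ D.domain, ρ b x ∈ D.domain
  J_sq : ∀ x, J (J x) = εJ • x
  J_dom : ∀ x ∈ D.domain, J x ∈ D.domain
  J_D : ∀ x : D.domain, J (D x) = ε • D ⟨J x, J_dom x x.2⟩
  commutant : ∀ a b, Commute (ρ a) (conjRep J ρ b)

/-- The first-order condition `[[D, a], J b J⁻¹] = 0` for all `a, b` in the algebra, as an identity
on the domain of `D`, which is preserved by `a` and `J b J⁻¹`. -/
structure FirstOrderCondition (ρ : B →+* Module.End ℂ N) (D : N →ₗ.[ℂ] N)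
    (J : N ≃ₛₗ[starRingEnd ℂ] N) : Prop where
  dom : ∀ b, ∀ x ∈ D.domain, ρ b x ∈ D.domain
  dom_conj : ∀ b, ∀ x ∈ D.domain, conjRep J ρ b x ∈ D.domain
  comm : ∀ (a b : B) (x : D.domain),
    commutator D (ρ a) (dom a) ⟨conjRep J ρ b x, dom_conj b x x.2⟩ =
      conjRep J ρ b (commutator D (ρ a) (dom a) x)

end RealStructure

/-- A real spectral triple `(A, H, D; J)` over a unital involutive algebra `A` over `k`
(`k = ℝ` or `k = ℂ`): a unital `*`-representation of `A` on the complex Hilbert space `H`, a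
self-adjoint operator `D` with compact resolvent such that all `[D, a]` are (defined on the domain
of `D` and) bounded, and an antiunitary `J` with `J² = εJ`, `J D J⁻¹ = ε D` (signs `εJ, ε = ± 1`)
and `[a, J b J⁻¹] = 0`. The first-order condition is not required. -/
structure RealSpectralTriple (k A H : Type*) [RCLike k] [Algebra k ℂ] [StarModule k ℂ]
    [Ring A] [StarRing A] [Algebra k A] [StarModule k A]
    [NormedAddCommGroup H] [InnerProductSpace ℂ H] [CompleteSpace H] where
  /-- the representation of the algebra by bounded operators -/
  π : A →+* (H →L[ℂ] H)
  π_star : ∀ a, π (star a) = ContinuousLinearMap.adjoint (π a)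
  π_algebraMap : ∀ r : k, π (algebraMap k A r) = algebraMap k ℂ r • (1 : H →L[ℂ] H)
  D : H →ₗ.[ℂ] H
  D_dense : Dense (D.domain : Set H)
  D_selfAdjoint : IsSelfAdjoint D
  /-- `(D - i)⁻¹` is a compact operator -/
  compact_resolvent : ∃ T : H →L[ℂ] H, IsCompactOperator T ∧
    (∀ x, ∃ h : T x ∈ D.domain, D ⟨T x, h⟩ - Complex.I • T x = x) ∧
    ∀ x : D.domain, T (D x - Complex.I • (x : H)) = x
  J : H ≃ₗᵢ⋆[ℂ] H
  εJ : ℤˣ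
  ε : ℤˣ
  isReal : IsRealStructure ((ContinuousLinearMap.toLinearMapRingHom).comp π) D
    J.toLinearEquiv εJ ε
  bounded_commutator : ∀ a, ∃ T : H →L[ℂ] H, ∀ x : D.domain,
    T x = commutator D (π a : H →ₗ[ℂ] H) (isReal.dom a) x

/-! ### One-forms and connections -/

section Forms

/-- The universal one-forms `Ω¹(A)`: the kernel of the multiplication `A ⊗ A → A`. -/
def UnivForm (k A : Type*) [Field k] [Ring A] [Algebra k A] : Type _ :=
  LinearMap.ker (LinearMap.mul' k A)

variable (k : Type*) {A : Type*} [Field k] [Ring A] [Algebra k A]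

instance : AddCommGroup (UnivForm k A) :=
  inferInstanceAs (AddCommGroup (LinearMap.ker (LinearMap.mul' k A)))

theorem mul'_rTensor (a : A) (t : A ⊗[k] A) :
    LinearMap.mul' k A ((LinearMap.mulLeft k a).rTensor A t) = a * LinearMap.mul' k A t := by
  induction t using TensorProduct.induction_on with
  | zero => simp
  | tmul x y => simp [mul_assoc]
  | add s t hs ht => simp only [map_add, hs, ht, mul_add]

theorem mul'_lTensor (a : A) (t : A ⊗[k] A) :
    LinearMap.mul' k A ((LinearMap.mulRight k a).lTensor A t) = LinearMap.mul' k A t * a := by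
  induction t using TensorProduct.induction_on with
  | zero => simp
  | tmul x y => simp [mul_assoc]
  | add s t hs ht => simp only [map_add, hs, ht, add_mul]

/-- The right action of `A` on universal one-forms: `(x ⊗ y) a = x ⊗ y a`. -/
instance UnivForm.rightModule : Module Aᵐᵒᵖ (UnivForm k A) where
  smul a ω := ⟨(LinearMap.mulRight k (unop a)).lTensor A ω.1, by
    have h : LinearMap.mul' k A ω.1 = 0 := ω.2
    rw [LinearMap.mem_ker, mul'_lTensor, h, zero_mul]⟩
  one_smul ω := Subtype.ext (by
    change (LinearMap.mulRight k (1 : A)).lTensor A ω.1 = ω.1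
    simp)
  mul_smul a b ω := Subtype.ext (by
    change (LinearMap.mulRight k (unop b * unop a)).lTensor A ω.1 =
      (LinearMap.mulRight k (unop a)).lTensor A ((LinearMap.mulRight k (unop b)).lTensor A ω.1)
    simp [LinearMap.mulRight_mul, LinearMap.lTensor_comp])
  smul_zero a := Subtype.ext (map_zero ((LinearMap.mulRight k (unop a)).lTensor A))
  smul_add a ω η := Subtype.ext (map_add ((LinearMap.mulRight k (unop a)).lTensor A) ω.1 η.1)
  add_smul a b ω := Subtype.ext (by
    change (LinearMap.mulRight k (unop a + unop b)).lTensor A ω.1 =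
      (LinearMap.mulRight k (unop a)).lTensor A ω.1 + (LinearMap.mulRight k (unop b)).lTensor A ω.1
    rw [← LinearMap.add_apply, ← LinearMap.lTensor_add]
    congr 2; ext; simp [mul_add])
  zero_smul ω := Subtype.ext (by
    change (LinearMap.mulRight k (0 : A)).lTensor A ω.1 = 0
    simp)

/-- The left action of `A` on universal one-forms: `a (x ⊗ y) = a x ⊗ y`. -/
def UnivForm.left : A →+* Module.End Aᵐᵒᵖ (UnivForm k A) where
  toFun a :=
    { toFun := fun ω => ⟨(LinearMap.mulLeft k a).rTensor A ω.1, by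
        have h : LinearMap.mul' k A ω.1 = 0 := ω.2
        rw [LinearMap.mem_ker, mul'_rTensor, h, mul_zero]⟩
      map_add' := fun ω η => Subtype.ext (map_add ((LinearMap.mulLeft k a).rTensor A) ω.1 η.1)
      map_smul' := fun b ω => Subtype.ext (by
        change (LinearMap.mulLeft k a).rTensor A ((LinearMap.mulRight k (unop b)).lTensor A ω.1) =
          (LinearMap.mulRight k (unop b)).lTensor A ((LinearMap.mulLeft k a).rTensor A ω.1)
        rw [← LinearMap.comp_apply, ← LinearMap.comp_apply, LinearMap.rTensor_comp_lTensor,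
          LinearMap.lTensor_comp_rTensor]) }
  map_one' := LinearMap.ext fun ω => Subtype.ext (by
    change (LinearMap.mulLeft k (1 : A)).rTensor A ω.1 = ω.1
    simp)
  map_mul' a b := LinearMap.ext fun ω => Subtype.ext (by
    change (LinearMap.mulLeft k (a * b)).rTensor A ω.1 =
      (LinearMap.mulLeft k a).rTensor A ((LinearMap.mulLeft k b).rTensor A ω.1)
    simp [LinearMap.mulLeft_mul, LinearMap.rTensor_comp])
  map_zero' := LinearMap.ext fun ω => Subtype.ext (by
    change (LinearMap.mulLeft k (0 : A)).rTensor A ω.1 = 0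
    simp)
  map_add' a b := LinearMap.ext fun ω => Subtype.ext (by
    change (LinearMap.mulLeft k (a + b)).rTensor A ω.1 =
      (LinearMap.mulLeft k a).rTensor A ω.1 + (LinearMap.mulLeft k b).rTensor A ω.1
    rw [← LinearMap.add_apply, ← LinearMap.rTensor_add]
    congr 2; ext; simp [add_mul])

/-- The universal differential `δ b = 1 ⊗ b - b ⊗ 1`. -/
def UnivForm.δ (b : A) : UnivForm k A :=
  ⟨(1 : A) ⊗ₜ[k] b - b ⊗ₜ[k] (1 : A), by simp⟩

end Forms

/-- A connection on the right `A`-module `E` with values in the `A`-bimodule `Ω` (left action `ℓ`),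
relative to `d : A → Ω`: an additive map `∇ : E → E ⊗_A Ω` with `∇(v a) = ∇(v) a + v ⊗ d a`. -/
structure Connection {A Ω : Type*} [Ring A] [AddCommGroup Ω] [Module Aᵐᵒᵖ Ω]
    (ℓ : A →+* Module.End Aᵐᵒᵖ Ω) (d : A → Ω) (E : Type*) [AddCommGroup E] [Module Aᵐᵒᵖ E] where
  toFun : E →+ BalTensor ℓ E
  leibniz : ∀ (v : E) (a : A), toFun (op a • v) = op a • toFun v + tmul ℓ v (d a)

/-- Universal connections `∇ : E → E ⊗_A Ω¹(A)`. -/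
abbrev UnivConnection (k A E : Type*) [Field k] [Ring A] [Algebra k A] [AddCommGroup E]
    [Module Aᵐᵒᵖ E] : Type _ :=
  Connection (UnivForm.left k (A := A)) (UnivForm.δ k (A := A)) E

/-- `∇ v = ∑ᵢ wᵢ ⊗ aᵢ δ(bᵢ)`. -/
def UnivConnection.Expansion {k A E : Type*} [Field k] [Ring A] [Algebra k A] [AddCommGroup E]
    [Module Aᵐᵒᵖ E] (nabla : UnivConnection k A E) (v : E) {n : ℕ} (w : Fin n → E)
    (a b : Fin n → A) : Prop :=
  nabla.toFun v =
    ∑ i, tmul (UnivForm.left k) (w i) (UnivForm.left k (a i) (UnivForm.δ k (b i)))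

/-- The graph of the operator `1 ⊗_∇ T` on `E ⊗_A N`, for an operator `T` with graph `G` in a space
`N` on which `A` acts through `ρ`. It is spanned by the pairs `(v ⊗ x, ∇_T(v) x + v ⊗ T x)` with `x`
in the domain of `T`, where a one-form `a δ(b)` is represented by `a [T, b]`:
if `∇ v = ∑ᵢ wᵢ ⊗ aᵢ δ(bᵢ)` then `∇_T(v) x = ∑ᵢ wᵢ ⊗ aᵢ (T (bᵢ x) - bᵢ (T x))`. -/
def twistGraph {k A E N : Type*} [Field k] [Ring A] [Algebra k A] [AddCommGroup E]
    [Module Aᵐᵒᵖ E] [AddCommGroup N] [Module ℂ N] (nabla : UnivConnection k A E)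
    (ρ : A →+* Module.End ℂ N) (G : Submodule ℂ (N × N)) :
    Submodule ℂ (BalTensor ρ E × BalTensor ρ E) :=
  Submodule.span ℂ {p | ∃ (v : E) (n : ℕ) (w : Fin n → E) (a b : Fin n → A) (x y : N)
    (z : Fin n → N), nabla.Expansion v w a b ∧ (x, y) ∈ G ∧ (∀ i, (ρ (b i) x, z i) ∈ G) ∧
    p = (tmul ρ v x, ∑ i, tmul ρ (w i) (ρ (a i) (z i - ρ (b i) y)) + tmul ρ v y)}

/-! ### The Morita-equivalent triple -/

namespace RealSpectralTriple

variable {k A H : Type*} [RCLike k] [Algebra k ℂ] [StarModule k ℂ]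
  [Ring A] [StarRing A] [Algebra k A] [StarModule k A]
  [NormedAddCommGroup H] [InnerProductSpace ℂ H] [CompleteSpace H]
  (S : RealSpectralTriple k A H) (E : Type*) [AddCommGroup E] [Module Aᵐᵒᵖ E]

/-- The left action of `A` on `H`. -/
def rep : A →+* Module.End ℂ H := (ContinuousLinearMap.toLinearMapRingHom).comp S.π

/-- The real structure as a semilinear bijection. -/
def conj : H ≃ₛₗ[starRingEnd ℂ] H := S.J.toLinearEquiv

/-- `(A, H, D; J)` satisfies the first-order condition. -/
def FirstOrder : Prop := FirstOrderCondition S.rep S.D S.conj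

/-- The representation `a ↦ J a J⁻¹` of `A` on `H`; the right action of `A` on `H` is
`ξ a = J a* J⁻¹ ξ`. -/
def hat : A →+* Module.End ℂ H := conjRep S.conj S.rep

theorem rep_hat_commute (a b : A) : Commute (S.rep a) (S.hat b) := S.isReal.commutant a b

/-- `E ⊗_A H`. -/
abbrev LeftSpace : Type _ := BalTensor S.rep E

/-- The operators `1 ⊗ J a J⁻¹` on `E ⊗_A H`; the right action of `A` on `E ⊗_A H` is
`(v ⊗ ξ) a = v ⊗ J a* J⁻¹ ξ`. -/
def leftHat : A →+* Module.End ℂ (S.LeftSpace E) :=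
  inducedAction S.rep E S.hat S.rep_hat_commute

/-- `E ⊗_A H ⊗_A Ē`. -/
abbrev Space : Type _ := BalTensor (S.leftHat E) E

variable {E}

/-- The elementary tensor `v₁ ⊗ ξ ⊗ v̄₂`. -/
def tmul₃ (v₁ : E) (ξ : H) (v₂ : E) : S.Space E := tmul (S.leftHat E) v₂ (tmul S.rep v₁ ξ)

variable (E)

theorem endAction_leftHat_commute (a : A) (φ : Module.End Aᵐᵒᵖ E) :
    Commute (S.leftHat E a) (endAction S.rep E φ) := by
  refine BalTensor.hom_ext S.rep fun v n => ?_
  rw [Module.End.mul_apply, Module.End.mul_apply, endAction_tmul, leftHat, inducedAction_tmul,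
    inducedAction_tmul, endAction_tmul]

/-- The action of `End_A(E)` on `E ⊗_A H ⊗_A Ē`: `φ (v₁ ⊗ ξ ⊗ v̄₂) = φ v₁ ⊗ ξ ⊗ v̄₂`. -/
def moritaRep : Module.End Aᵐᵒᵖ E →+* Module.End ℂ (S.Space E) :=
  inducedAction (S.leftHat E) E (endAction S.rep E) (S.endAction_leftHat_commute E)

theorem leftHat_tmul (a : A) (v : E) (ξ : H) :
    S.leftHat E a (tmul S.rep v ξ) = tmul S.rep v (S.hat a ξ) :=
  inducedAction_tmul _ _ _ _ _ _

/-- For an antilinear `j` on `H` with `j a = J a J⁻¹ j`, the antilinear map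
`v₁ ⊗ ξ ↦ v₂ ⊗ j ξ ⊗ v̄₁`. -/
def flipAux (j : H →ₛₗ[starRingEnd ℂ] H) (h₁ : ∀ a ξ, j (S.rep a ξ) = S.hat a (j ξ)) (v₂ : E) :
    S.LeftSpace E →ₛₗ[starRingEnd ℂ] S.Space E :=
  BalTensor.lift S.rep
    { toFun := fun v₁ => (tmulHom (S.leftHat E) v₁).comp ((tmulHom S.rep v₂).comp j)
      map_zero' := by rw [map_zero, LinearMap.zero_comp]
      map_add' := fun v w => by rw [map_add, LinearMap.add_comp] }
    (fun v a ξ => by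
      change tmul _ v (tmul _ v₂ (j (S.rep a ξ))) = tmul _ (op a • v) (tmul _ v₂ (j ξ))
      rw [h₁, tmul_balanced, leftHat_tmul])

theorem flipAux_tmul (j : H →ₛₗ[starRingEnd ℂ] H)
    (h₁ : ∀ a ξ, j (S.rep a ξ) = S.hat a (j ξ)) (v₁ v₂ : E) (ξ : H) :
    S.flipAux E j h₁ v₂ (tmul S.rep v₁ ξ) = S.tmul₃ v₂ (j ξ) v₁ := rfl

/-- For an antilinear `j` on `H` with `j a = J a J⁻¹ j` and `j J a J⁻¹ = a j`, the antilinear map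
`v₁ ⊗ ξ ⊗ v̄₂ ↦ v₂ ⊗ j ξ ⊗ v̄₁`. -/
def flip (j : H →ₛₗ[starRingEnd ℂ] H) (h₁ : ∀ a ξ, j (S.rep a ξ) = S.hat a (j ξ))
    (h₂ : ∀ a ξ, j (S.hat a ξ) = S.rep a (j ξ)) : S.Space E →ₛₗ[starRingEnd ℂ] S.Space E :=
  BalTensor.lift (S.leftHat E)
    { toFun := S.flipAux E j h₁
      map_zero' := BalTensor.hom_ext S.rep fun v ξ => by
        rw [flipAux_tmul, tmul₃, ← tmulHom_apply S.rep, map_zero]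
        exact map_zero (tmulHom (S.leftHat E) v)
      map_add' := fun v w => BalTensor.hom_ext S.rep fun u ξ => by
        rw [LinearMap.add_apply, flipAux_tmul, flipAux_tmul, flipAux_tmul, tmul₃,
          ← tmulHom_apply S.rep, map_add]
        exact map_add (tmulHom (S.leftHat E) u) _ _ }
    (fun v a x => by
      change S.flipAux E j h₁ v (S.leftHat E a x) = S.flipAux E j h₁ (op a • v) x
      induction x using BalTensor.induction S.rep with
      | h0 => simp only [map_zero]
      | ht u ξ => rw [leftHat_tmul, flipAux_tmul, flipAux_tmul, h₂, tmul₃, tmul₃, tmul_balanced]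
      | ha x y hx hy => rw [map_add, map_add, map_add, hx, hy])

theorem flip_tmul₃ (j : H →ₛₗ[starRingEnd ℂ] H)
    (h₁ : ∀ a ξ, j (S.rep a ξ) = S.hat a (j ξ))
    (h₂ : ∀ a ξ, j (S.hat a ξ) = S.rep a (j ξ)) (v₁ v₂ : E) (ξ : H) :
    S.flip E j h₁ h₂ (S.tmul₃ v₁ ξ v₂) = S.tmul₃ v₂ (j ξ) v₁ := rfl

theorem Space.induction {p : S.Space E → Prop} (h0 : p 0)
    (ht : ∀ v₁ ξ v₂, p (S.tmul₃ v₁ ξ v₂)) (ha : ∀ x y, p x → p y → p (x + y)) (x : S.Space E) :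
    p x := by
  induction x using BalTensor.induction (S.leftHat E) with
  | h0 => exact h0
  | ht v₂ y =>
    induction y using BalTensor.induction S.rep with
    | h0 => rw [← tmulHom_apply, map_zero]; exact h0
    | ht v₁ ξ => exact ht v₁ ξ v₂
    | ha x y hx hy =>
      have : tmul (S.leftHat E) v₂ (x + y) =
          tmul (S.leftHat E) v₂ x + tmul (S.leftHat E) v₂ y := map_add (tmulHom _ v₂) x y
      rw [this]; exact ha _ _ hx hy
  | ha x y hx hy => exact ha _ _ hx hy

theorem conj_sq (ξ : H) : S.conj (S.conj ξ) = S.εJ • ξ := S.isReal.J_sq ξ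

theorem conj_symm (ξ : H) : S.conj.symm ξ = S.εJ • S.conj ξ := by
  rw [LinearEquiv.symm_apply_eq]
  have h : S.conj (S.εJ • S.conj ξ) = S.εJ • S.conj (S.conj ξ) :=
    map_zsmul S.conj.toAddEquiv (S.εJ : ℤ) (S.conj ξ)
  rw [h, conj_sq, smul_smul, Int.units_mul_self, one_smul]

theorem conj_rep (a : A) (ξ : H) : S.conj (S.rep a ξ) = S.hat a (S.conj ξ) := by
  simp [hat]

theorem symm_hat (a : A) (ξ : H) : S.conj.symm (S.hat a ξ) = S.rep a (S.conj.symm ξ) := by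
  simp [hat]

theorem rep_units_smul (a : A) (u : ℤˣ) (ξ : H) : S.rep a (u • ξ) = u • S.rep a ξ :=
  map_zsmul (S.rep a) (u : ℤ) ξ

theorem hat_units_smul (a : A) (u : ℤˣ) (ξ : H) : S.hat a (u • ξ) = u • S.hat a ξ :=
  map_zsmul (S.hat a) (u : ℤ) ξ

theorem conj_hat (a : A) (ξ : H) : S.conj (S.hat a ξ) = S.rep a (S.conj ξ) := by
  have h := S.symm_hat a ξ
  rw [conj_symm, conj_symm, rep_units_smul] at h
  exact smul_left_cancel _ h

theorem symm_rep (a : A) (ξ : H) : S.conj.symm (S.rep a ξ) = S.hat a (S.conj.symm ξ) := by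
  rw [conj_symm, conj_symm, hat_units_smul, conj_rep]

/-- The real structure `J' (v₁ ⊗ ξ ⊗ v̄₂) = v₂ ⊗ J ξ ⊗ v̄₁` on `E ⊗_A H ⊗_A Ē`. -/
def moritaJ : S.Space E ≃ₛₗ[starRingEnd ℂ] S.Space E :=
  LinearEquiv.ofLinearMap (S.flip E S.conj.toLinearMap S.conj_rep S.conj_hat)
    (S.flip E S.conj.symm.toLinearMap S.symm_rep S.symm_hat)
    (by
      refine LinearMap.ext fun x => ?_
      induction x using Space.induction S E with
      | h0 => simp
      | ht v₁ ξ v₂ => simp [flip_tmul₃]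
      | ha x y hx hy => rw [map_add, map_add, hx, hy])
    (by
      refine LinearMap.ext fun x => ?_
      induction x using Space.induction S E with
      | h0 => simp
      | ht v₁ ξ v₂ => simp [flip_tmul₃]
      | ha x y hx hy => rw [map_add, map_add, hx, hy])

theorem moritaJ_tmul₃ (v₁ v₂ : E) (ξ : H) :
    S.moritaJ E (S.tmul₃ v₁ ξ v₂) = S.tmul₃ v₂ (S.J ξ) v₁ :=
  S.flip_tmul₃ E S.conj.toLinearMap S.conj_rep S.conj_hat v₁ v₂ ξ

variable {E}

/-- The graph of `D' = (1 ⊗_∇ D) ⊗_∇̄ 1`. The conjugate left connection `∇̄` on `Ē` is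
`∇̄(v̄) = ∑ᵢ δ(bᵢ*) aᵢ* ⊗ w̄ᵢ` if `∇ v = ∑ᵢ wᵢ ⊗ aᵢ δ(bᵢ)`, and for an operator `T` on a
right `A`-module the one-form `δ(c) a` acts on the right as `x ↦ (T (x c) - (T x) c) a`. Since right
multiplication by `c*` is `J c J⁻¹`, one gets
`(T ⊗_∇̄ 1)(x ⊗ v̄) = T x ⊗ v̄ + ∑ᵢ (J aᵢ J⁻¹ [T, J bᵢ J⁻¹] x) ⊗ w̄ᵢ`,
the twist of `T` by `∇` and the representation `a ↦ J a J⁻¹`. -/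
def moritaGraph (nabla : UnivConnection k A E) : Submodule ℂ (S.Space E × S.Space E) :=
  twistGraph nabla (S.leftHat E) (twistGraph nabla S.rep S.D.graph)

/-- The fluctuated operator `D' = (1 ⊗_∇ D) ⊗_∇̄ 1` on `E ⊗_A H ⊗_A Ē`. -/
def moritaD (nabla : UnivConnection k A E) : S.Space E →ₗ.[ℂ] S.Space E :=
  (S.moritaGraph nabla).toLinearPMap

/-! ### Represented one-forms and the usual inner fluctuation -/

/-- The bounded operator `[D, a]` on `H`. -/
def dD (a : A) : H →L[ℂ] H := (S.bounded_commutator a).choose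

theorem dD_apply (a : A) (x : S.D.domain) :
    S.dD a x = S.D ⟨S.π a x, S.isReal.dom a x x.2⟩ - S.π a (S.D x) :=
  (S.bounded_commutator a).choose_spec x

theorem dD_mul (a b : A) : S.dD (a * b) = S.dD a * S.π b + S.π a * S.dD b := by
  apply ContinuousLinearMap.coeFn_injective
  refine Continuous.ext_on S.D_dense (S.dD (a * b)).continuous
    (S.dD a * S.π b + S.π a * S.dD b).continuous ?_
  intro x hx
  have hb := S.isReal.dom b x hx
  have h1 := S.dD_apply (a * b) ⟨x, hx⟩
  have h2 := S.dD_apply b ⟨x, hx⟩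
  have h3 := S.dD_apply a ⟨S.π b x, hb⟩
  have h4 : S.D ⟨S.π (a * b) x, S.isReal.dom (a * b) x hx⟩ =
      S.D ⟨S.π a (S.π b x), S.isReal.dom a _ hb⟩ := by
    congr 2
    rw [map_mul]; rfl
  change S.dD (a * b) x = S.dD a (S.π b x) + S.π a (S.dD b x)
  rw [h1, h2, h3, h4, map_sub, map_mul]
  change _ - S.π a (S.π b (S.D ⟨x, hx⟩)) = _
  abel

/-- `Ω¹_D(A)`: the operators `∑ⱼ aⱼ [D, bⱼ]` on `H`. -/
def forms : AddSubgroup (H →L[ℂ] H) := AddSubgroup.closure {T | ∃ a b, T = S.π a * S.dD b}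

theorem forms_mul_right {T : H →L[ℂ] H} (hT : T ∈ S.forms) (c : A) : T * S.π c ∈ S.forms := by
  induction hT using AddSubgroup.closure_induction with
  | mem T h =>
    obtain ⟨a, b, rfl⟩ := h
    have : S.π a * S.dD b * S.π c = S.π a * S.dD (b * c) - S.π (a * b) * S.dD c := by
      rw [dD_mul, map_mul]; noncomm_ring
    rw [this]
    exact S.forms.sub_mem (AddSubgroup.subset_closure ⟨_, _, rfl⟩)
      (AddSubgroup.subset_closure ⟨_, _, rfl⟩)
  | zero => rw [zero_mul]; exact S.forms.zero_mem
  | add x y _ _ hx hy => rw [add_mul]; exact S.forms.add_mem hx hy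
  | neg x _ hx => rw [neg_mul]; exact S.forms.neg_mem hx

theorem forms_mul_left {T : H →L[ℂ] H} (hT : T ∈ S.forms) (c : A) : S.π c * T ∈ S.forms := by
  induction hT using AddSubgroup.closure_induction with
  | mem T h =>
    obtain ⟨a, b, rfl⟩ := h
    exact AddSubgroup.subset_closure ⟨c * a, b, by rw [map_mul, mul_assoc]⟩
  | zero => rw [mul_zero]; exact S.forms.zero_mem
  | add x y _ _ hx hy => rw [mul_add]; exact S.forms.add_mem hx hy
  | neg x _ hx => rw [mul_neg]; exact S.forms.neg_mem hx

/-- `Ω¹_D(A)` as a type. -/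
def Form : Type _ := S.forms

instance : AddCommGroup S.Form := inferInstanceAs (AddCommGroup S.forms)

/-- The operator on `H` given by an element of `Ω¹_D(A)`. -/
def Form.op (ω : S.Form) : H →L[ℂ] H := ω.1

/-- The right action of `A` on `Ω¹_D(A)`. -/
instance Form.rightModule : Module Aᵐᵒᵖ S.Form where
  smul a ω := ⟨ω.1 * S.π (unop a), S.forms_mul_right ω.2 _⟩
  one_smul ω := Subtype.ext (by change ω.1 * S.π 1 = ω.1; simp)
  mul_smul a b ω := Subtype.ext (by
    change ω.1 * S.π (unop b * unop a) = ω.1 * S.π (unop b) * S.π (unop a)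
    rw [map_mul, mul_assoc])
  smul_zero a := Subtype.ext (zero_mul _)
  smul_add a ω η := Subtype.ext (add_mul ω.1 η.1 _)
  add_smul a b ω := Subtype.ext (by
    change ω.1 * S.π (unop a + unop b) = ω.1 * S.π (unop a) + ω.1 * S.π (unop b)
    rw [map_add, mul_add])
  zero_smul ω := Subtype.ext (by change ω.1 * S.π 0 = 0; simp)

/-- The left action of `A` on `Ω¹_D(A)`. -/
def Form.left : A →+* Module.End Aᵐᵒᵖ S.Form where
  toFun a :=
    { toFun := fun ω => ⟨S.π a * ω.1, S.forms_mul_left ω.2 a⟩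
      map_add' := fun ω η => Subtype.ext (mul_add _ ω.1 η.1)
      map_smul' := fun b ω => Subtype.ext (mul_assoc (S.π a) ω.1 (S.π (unop b))).symm }
  map_one' := LinearMap.ext fun ω => Subtype.ext (by change S.π 1 * ω.1 = ω.1; simp)
  map_mul' a b := LinearMap.ext fun ω => Subtype.ext (by
    change S.π (a * b) * ω.1 = S.π a * (S.π b * ω.1)
    rw [map_mul, mul_assoc])
  map_zero' := LinearMap.ext fun ω => Subtype.ext (by change S.π 0 * ω.1 = 0; simp)
  map_add' a b := LinearMap.ext fun ω => Subtype.ext (by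
    change S.π (a + b) * ω.1 = S.π a * ω.1 + S.π b * ω.1
    rw [map_add, add_mul])

/-- The differential `b ↦ [D, b]` with values in `Ω¹_D(A)`. -/
def Form.d (b : A) : S.Form :=
  ⟨S.dD b, AddSubgroup.subset_closure ⟨1, b, by rw [map_one, one_mul]⟩⟩

variable (E) in
/-- Connections `∇ : E → E ⊗_A Ω¹_D(A)`. -/
abbrev DConnection : Type _ := Connection (Form.left S) (Form.d S) E

/-- `nablaD : E → E ⊗_A Ω¹_D(A)` represents the universal connection `nabla`: it is obtained from it
by `a δ(b) ↦ a [D, b]`. -/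
def Represents (nablaD : S.DConnection E) (nabla : UnivConnection k A E) : Prop :=
  ∀ (v : E) (n : ℕ) (w : Fin n → E) (a b : Fin n → A), nabla.Expansion v w a b →
    nablaD.toFun v = ∑ i, tmul (Form.left S) (w i) (Form.left S (a i) (Form.d S (b i)))

/-- The graph of the usual inner fluctuation of `D` by a connection
`∇ : E → E ⊗_A Ω¹_D(A)`, that is, of the operator
`v₁ ⊗ ξ ⊗ v̄₂ ↦ ∇(v₁) ξ ⊗ v̄₂ + v₁ ⊗ D ξ ⊗ v̄₂ + v₁ ⊗ ξ ∇̄(v̄₂)` with `ξ` in the domain of `D`.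
If `∇ v₁ = ∑ᵢ wᵢ ⊗ ωᵢ` then `∇(v₁) ξ = ∑ᵢ wᵢ ⊗ ωᵢ ξ`, and if `∇ v₂ = ∑ⱼ uⱼ ⊗ ηⱼ` then
`ξ ∇̄(v̄₂) = ∑ⱼ ε J ηⱼ J⁻¹ ξ ⊗ ūⱼ`. -/
def usualGraph (nablaD : S.DConnection E) : Submodule ℂ (S.Space E × S.Space E) :=
  Submodule.span ℂ {p | ∃ (v₁ v₂ : E) (ξ : S.D.domain) (m n : ℕ) (w : Fin m → E)
    (ω : Fin m → S.Form) (u : Fin n → E) (η : Fin n → S.Form),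
    nablaD.toFun v₁ = ∑ i, tmul (Form.left S) (w i) (ω i) ∧
    nablaD.toFun v₂ = ∑ j, tmul (Form.left S) (u j) (η j) ∧
    p = (S.tmul₃ v₁ ξ v₂,
      ∑ i, S.tmul₃ (w i) (Form.op S (ω i) ξ) v₂ + S.tmul₃ v₁ (S.D ξ) v₂ +
        ∑ j, S.tmul₃ v₁ (S.ε • S.J (Form.op S (η j) (S.J.symm ξ))) (u j))}

end RealSpectralTriple

end NCG

end

/-!
Choose dual bases for the finitely generated projective module `E`: the contractions with them show
that `E ⊗_A Dom(T) → E ⊗_A N` is injective for every operator `T` on a space `N` on which `A` acts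
preserving `Dom(T)` (`BalTensor.map_injective`). On `E ⊗_A Dom(T)` the formula
`v ⊗ x ↦ ∇_T(v) x + v ⊗ T x` is balanced over `A` by the Leibniz rule (`twistOp`), and one-forms act
by `∑ xᵢ ⊗ yᵢ ↦ ∑ xᵢ T yᵢ`, independently of expansions. Hence the graph of `1 ⊗_∇ T` is the image
of `E ⊗_A Dom(T)` and is the graph of an operator (`twistGraph_eq_range`,
`graph_toLinearPMap_twistGraph`). This applies to `D` on `H` and then, for the representation
`1 ⊗ J a J⁻¹`, to `1 ⊗_∇ D` on `E ⊗_A H`.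

The first-order condition enters through boundedness of `[D, a]`: since `Dom(D)` is dense, all of
`Ω¹_D(A)` commutes with `J A J⁻¹` (`FirstOrder.op_hat`). Therefore
`[1 ⊗_∇ D, 1 ⊗ J b J⁻¹] = 1 ⊗ [D, J b J⁻¹] = 1 ⊗ ε J [D, b] J⁻¹`, which turns the second twist into
the right action of `∇^D` and gives the inner fluctuation formula on elementary tensors
(`FirstOrder.moritaD_tmul₃`). In that formula `J'` exchanges the two one-form terms, which gives
`J' D' J'⁻¹ = ε D'`. Moreover `[D', φ]` only involves the first two tensor factors, whereas
`J' ψ J'⁻¹` acts on the last one, so that the two commute.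
-/

noncomputable section

namespace NCG

/-! ### Additive maps out of balanced tensor products -/

section Lift

variable {A R N : Type*} [Ring A] [Ring R] [AddCommGroup N] [Module R N]
  (ρ : A →+* Module.End R N) {E : Type*} [AddCommGroup E] [Module Aᵐᵒᵖ E]

/-- A balanced biadditive map factors through `E ⊗_A N`; no compatibility with the scalars `R` is
needed, because the relations defining `E ⊗_A N` are stable under `R`. -/
def BalTensor.liftAdd {P : Type*} [AddCommGroup P] (f : E →+ (N →+ P))
    (hf : ∀ v a n, f v (ρ a n) = f (op a • v) n) : BalTensor ρ E →+ P :=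
  QuotientAddGroup.lift (balRel ρ E).toAddSubgroup
    (TensorProduct.liftAddHom f.flip (fun r n v => by simp)) (by
      intro t ht
      suffices h : ∀ r : R, TensorProduct.liftAddHom f.flip (fun r n v => by simp) (r • t) = 0 by
        simpa using h 1
      refine Submodule.span_induction (p := fun t _ => ∀ r : R, TensorProduct.liftAddHom f.flip
        (fun r n v => by simp) (r • t) = 0) ?_ ?_ ?_ ?_ ht
      · rintro _ ⟨v, a, n, rfl⟩ r
        rw [smul_sub, TensorProduct.smul_tmul', TensorProduct.smul_tmul', map_sub, ← map_smul,
          TensorProduct.liftAddHom_tmul, TensorProduct.liftAddHom_tmul, AddMonoidHom.flip_apply,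
          AddMonoidHom.flip_apply, hf, sub_self]
      · intro r; rw [smul_zero, map_zero]
      · intro x y _ _ hx hy r; rw [smul_add, map_add, hx, hy, add_zero]
      · intro s x _ hx r; rw [smul_smul]; exact hx _)

theorem BalTensor.smul_tmul (r : R) (v : E) (n : N) : r • tmul ρ v n = tmul ρ v (r • n) :=
  ((tmulHom ρ v).map_smul r n).symm

/-- Every element of `E ⊗_A N` is a finite sum of elementary tensors `v ⊗ n` with `n` in a set
generating `N` as an additive group. -/
theorem BalTensor.exists_sum {ι : Type*} (g : ι → N)
    (hg : ∀ n, ∃ (m : ℕ) (i : Fin m → ι), n = ∑ j, g (i j)) (x : BalTensor ρ E) :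
    ∃ (m : ℕ) (w : Fin m → E) (i : Fin m → ι), x = ∑ j, tmul ρ (w j) (g (i j)) := by
  induction x using BalTensor.induction ρ with
  | h0 => exact ⟨0, Fin.elim0, Fin.elim0, by simp⟩
  | ht v n =>
    obtain ⟨m, i, rfl⟩ := hg n
    exact ⟨m, fun _ => v, i, map_sum (tmulHom ρ v) _ _⟩
  | ha x y hx hy =>
    obtain ⟨m, w, i, rfl⟩ := hx
    obtain ⟨m', w', i', rfl⟩ := hy
    exact ⟨m + m', Fin.append w w', Fin.append i i', by simp [Fin.sum_univ_add]⟩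

end Lift

/-! ### Projective modules and injectivity -/

section Projective

variable {A R N M : Type*} [Ring A] [Ring R] [AddCommGroup N] [Module R N]
  [AddCommGroup M] [Module R M]
  (ρ : A →+* Module.End R N) (σ : A →+* Module.End R M)
  {E : Type*} [AddCommGroup E] [Module Aᵐᵒᵖ E]

variable (E) in
/-- The map `v ⊗ m ↦ v ⊗ g m` from `E ⊗_A M` to `E ⊗_A N`, for an `A`-linear map `g`. -/
def BalTensor.map (g : M →ₗ[R] N) (hg : ∀ a m, g (σ a m) = ρ a (g m)) :
    BalTensor σ E →ₗ[R] BalTensor ρ E :=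
  BalTensor.lift σ
    { toFun := fun v => (tmulHom ρ v).comp g
      map_zero' := by rw [map_zero, LinearMap.zero_comp]
      map_add' := fun v w => by rw [map_add, LinearMap.add_comp] } (fun v a m => by
      change tmul ρ v (g (σ a m)) = tmul ρ (op a • v) (g m)
      rw [tmul_balanced, hg])

theorem BalTensor.map_tmul (g : M →ₗ[R] N) (hg : ∀ a m, g (σ a m) = ρ a (g m)) (v : E) (m : M) :
    BalTensor.map ρ σ E g hg (tmul σ v m) = tmul ρ v (g m) := rfl

/-- A linear form `f` on `E` induces the contraction `v ⊗ n ↦ f(v) n` from `E ⊗_A N` to `N`. -/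
def BalTensor.contract (f : E →ₗ[Aᵐᵒᵖ] Aᵐᵒᵖ) : BalTensor ρ E →ₗ[R] N :=
  BalTensor.lift ρ
    { toFun := fun v => ρ (unop (f v))
      map_zero' := by simp
      map_add' := fun v w => by simp } (fun v a n => by simp)

theorem BalTensor.contract_tmul (f : E →ₗ[Aᵐᵒᵖ] Aᵐᵒᵖ) (v : E) (n : N) :
    BalTensor.contract ρ f (tmul ρ v n) = ρ (unop (f v)) n := rfl

/-- A finitely generated projective module is flat: tensoring with it preserves injectivity. The
contractions with a dual basis of `E` recover an element of `E ⊗_A M`, and they are compatible with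
`M → N`. -/
theorem BalTensor.map_injective [Module.Finite Aᵐᵒᵖ E] [Module.Projective Aᵐᵒᵖ E]
    (g : M →ₗ[R] N) (hg : ∀ a m, g (σ a m) = ρ a (g m)) (hinj : Function.Injective g) :
    Function.Injective (BalTensor.map ρ σ E g hg) := by
  obtain ⟨n, p, s, -, -, hps⟩ := Module.Finite.exists_comp_eq_id_of_projective Aᵐᵒᵖ E
  let f : Fin n → E →ₗ[Aᵐᵒᵖ] Aᵐᵒᵖ := fun i => LinearMap.proj i ∘ₗ s
  let e : Fin n → E := fun i => p fun j => if i = j then 1 else 0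
  have hv : ∀ v, v = ∑ i, f i v • e i := fun v => by
    conv_lhs => rw [← LinearMap.id_apply (R := Aᵐᵒᵖ) v, ← hps, LinearMap.comp_apply,
      LinearMap.pi_apply_eq_sum_univ p (s v)]
    rfl
  have hx : ∀ x : BalTensor σ E, x = ∑ i, tmul σ (e i) (BalTensor.contract σ (f i) x) := fun x => by
    induction x using BalTensor.induction σ with
    | h0 => simp [← tmulHom_apply]
    | ht v m =>
      conv_lhs => rw [hv v, ← tmulHom_apply, map_sum, LinearMap.sum_apply]
      refine Finset.sum_congr rfl fun i _ => ?_
      rw [BalTensor.contract_tmul, ← tmul_balanced]; rfl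
    | ha x y hx hy =>
      conv_lhs => rw [hx, hy, ← Finset.sum_add_distrib]
      simp only [← tmulHom_apply, map_add]
  have hc : ∀ (i : Fin n) (x : BalTensor σ E),
      BalTensor.contract ρ (f i) (BalTensor.map ρ σ E g hg x) =
        g (BalTensor.contract σ (f i) x) := fun i x => by
    induction x using BalTensor.induction σ with
    | h0 => simp
    | ht v m => rw [BalTensor.map_tmul, BalTensor.contract_tmul, BalTensor.contract_tmul, hg]
    | ha x y hx hy => simp only [map_add, hx, hy]
  refine (injective_iff_map_eq_zero _).2 fun x h => ?_
  rw [hx x]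
  refine Finset.sum_eq_zero fun i _ => ?_
  have : BalTensor.contract σ (f i) x = 0 := hinj (by rw [← hc, h, map_zero, map_zero])
  rw [this, ← tmulHom_apply, map_zero]

end Projective

/-! ### Universal one-forms acting as commutators -/

section Forms

/-- If one-forms `ω` act as operators `c ω : V → N` with `c (a ω) = a (c ω)`, then elements of
`E ⊗_A Ω` act as operators `V → E ⊗_A N`, by `(w ⊗ ω) x = w ⊗ c(ω) x`. -/
def evalForm {A Ω V N : Type*} [Ring A] [AddCommGroup Ω] [Module Aᵐᵒᵖ Ω]
    [AddCommGroup V] [Module ℂ V] [AddCommGroup N] [Module ℂ N]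
    (E : Type*) [AddCommGroup E] [Module Aᵐᵒᵖ E]
    (ℓ : A →+* Module.End Aᵐᵒᵖ Ω) (ρ : A →+* Module.End ℂ N) (c : Ω →+ (V →ₗ[ℂ] N))
    (hc : ∀ a ω x, c (ℓ a ω) x = ρ a (c ω x)) :
    BalTensor ℓ E →+ (V →ₗ[ℂ] BalTensor ρ E) :=
  BalTensor.liftAdd ℓ
    { toFun := fun w =>
        { toFun := fun ω => (tmulHom ρ w).comp (c ω)
          map_zero' := by rw [map_zero, LinearMap.comp_zero]
          map_add' := fun ω η => by rw [map_add, LinearMap.comp_add] }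
      map_zero' := by ext; simp
      map_add' := fun v w => by ext; simp }
    (fun v a ω => LinearMap.ext fun x => by
      change tmul ρ v (c (ℓ a ω) x) = tmul ρ (op a • v) (c ω x)
      rw [tmul_balanced, hc])

theorem evalForm_tmul {A Ω V N E : Type*} [Ring A] [AddCommGroup Ω] [Module Aᵐᵒᵖ Ω]
    [AddCommGroup V] [Module ℂ V] [AddCommGroup N] [Module ℂ N]
    [AddCommGroup E] [Module Aᵐᵒᵖ E]
    (ℓ : A →+* Module.End Aᵐᵒᵖ Ω) (ρ : A →+* Module.End ℂ N) (c : Ω →+ (V →ₗ[ℂ] N))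
    (hc : ∀ a ω x, c (ℓ a ω) x = ρ a (c ω x)) (w : E) (ω : Ω) (x : V) :
    evalForm E ℓ ρ c hc (tmul ℓ w ω) x = tmul ρ w (c ω x) := rfl

variable {k A : Type*} [Field k] [Ring A] [Algebra k A]

/-- A universal one-form is a sum of forms `a δ(b)`. -/
theorem UnivForm.exists_sum (ω : UnivForm k A) :
    ∃ (m : ℕ) (p : Fin m → A × A),
      ω = ∑ j, UnivForm.left k (p j).1 (UnivForm.δ k (p j).2) := by
  -- Modulo `A ⊗ 1`, every tensor `x ⊗ y` is `x δ(y)`; on the kernel of the product the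
  -- remaining term vanishes.
  have key : ∀ t : A ⊗[k] A, ∃ (m : ℕ) (p : Fin m → A × A),
      t = (∑ j, UnivForm.left k (p j).1 (UnivForm.δ k (p j).2)).1 +
        LinearMap.mul' k A t ⊗ₜ[k] (1 : A) := by
    intro t
    induction t using TensorProduct.induction_on with
    | zero => exact ⟨0, Fin.elim0, by simp; rfl⟩
    | tmul x y =>
      refine ⟨1, fun _ => (x, y), ?_⟩
      rw [Fin.sum_univ_one]
      change _ = (LinearMap.mulLeft k x).rTensor A ((1 : A) ⊗ₜ[k] y - y ⊗ₜ[k] (1 : A)) + _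
      simp
    | add s t hs ht =>
      obtain ⟨m, p, hp⟩ := hs
      obtain ⟨m', p', hp'⟩ := ht
      refine ⟨m + m', Fin.append p p', ?_⟩
      conv_lhs => rw [hp, hp']
      rw [Fin.sum_univ_add, map_add, TensorProduct.add_tmul]
      simp only [Fin.append_left, Fin.append_right]
      exact add_add_add_comm _ _ _ _
  obtain ⟨m, p, hp⟩ := key ω.1
  refine ⟨m, p, Subtype.ext ?_⟩
  have h : LinearMap.mul' k A ω.1 = 0 := ω.2
  rw [h, TensorProduct.zero_tmul, add_zero] at hp
  exact hp

theorem UnivConnection.exists_expansion {E : Type*} [AddCommGroup E] [Module Aᵐᵒᵖ E]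
    (nabla : UnivConnection k A E) (v : E) :
    ∃ (n : ℕ) (w : Fin n → E) (a b : Fin n → A), nabla.Expansion v w a b := by
  obtain ⟨n, w, p, h⟩ := BalTensor.exists_sum (UnivForm.left k (A := A))
    (fun p : A × A => UnivForm.left k p.1 (UnivForm.δ k p.2)) UnivForm.exists_sum (nabla.toFun v)
  exact ⟨n, w, fun j => (p j).1, fun j => (p j).2, h⟩

/-- The additive map on universal one-forms induced by a biadditive map on `A × A`, balanced over
`k`. -/
def UnivForm.lift {P : Type*} [AddCommGroup P] (f : A →+ A →+ P)
    (hf : ∀ (r : k) (x y : A), f (r • x) y = f x (r • y)) : UnivForm k A →+ P :=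
  (TensorProduct.liftAddHom f hf).comp (LinearMap.mul' k A).ker.subtype.toAddMonoidHom

theorem UnivForm.lift_apply {P : Type*} [AddCommGroup P] (f : A →+ A →+ P)
    (hf : ∀ (r : k) (x y : A), f (r • x) y = f x (r • y)) (ω : UnivForm k A) :
    UnivForm.lift f hf ω = TensorProduct.liftAddHom f hf ω.1 := rfl

theorem UnivForm.lift_δ {P : Type*} [AddCommGroup P] (f : A →+ A →+ P)
    (hf : ∀ (r : k) (x y : A), f (r • x) y = f x (r • y)) (b : A) :
    UnivForm.lift f hf (UnivForm.δ k b) = f 1 b - f b 1 := by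
  rw [UnivForm.lift_apply]
  exact map_sub (TensorProduct.liftAddHom f hf) _ _

theorem UnivForm.lift_left {P : Type*} [AddCommGroup P] (f : A →+ A →+ P)
    (hf : ∀ (r : k) (x y : A), f (r • x) y = f x (r • y)) (a : A) (g : P →+ P)
    (h : ∀ x y, f (a * x) y = g (f x y)) (ω : UnivForm k A) :
    UnivForm.lift f hf (UnivForm.left k a ω) = g (UnivForm.lift f hf ω) := by
  suffices H : ∀ t : A ⊗[k] A, TensorProduct.liftAddHom f hf
      ((LinearMap.mulLeft k a).rTensor A t) = g (TensorProduct.liftAddHom f hf t) from H ω.1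
  intro t
  induction t using TensorProduct.induction_on with
  | zero => simp
  | tmul x y => exact h x y
  | add s t hs ht => simp only [map_add, hs, ht]

theorem UnivForm.lift_right {P : Type*} [AddCommGroup P] (f : A →+ A →+ P)
    (hf : ∀ (r : k) (x y : A), f (r • x) y = f x (r • y)) (a : A) (g : P →+ P)
    (h : ∀ x y, f x (y * a) = g (f x y)) (ω : UnivForm k A) :
    UnivForm.lift f hf (op a • ω) = g (UnivForm.lift f hf ω) := by
  suffices H : ∀ t : A ⊗[k] A, TensorProduct.liftAddHom f hf
      ((LinearMap.mulRight k a).lTensor A t) = g (TensorProduct.liftAddHom f hf t) from H ω.1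
  intro t
  induction t using TensorProduct.induction_on with
  | zero => simp
  | tmul x y => exact h x y
  | add s t hs ht => simp only [map_add, hs, ht]

end Forms

/-! ### Twisting an operator by a universal connection -/

section Twist

variable {k A N : Type*} [Field k] [Ring A] [Algebra k A] [AddCommGroup N] [Module ℂ N]
  (ρ : A →+* Module.End ℂ N) (T : N →ₗ.[ℂ] N)
  (hdom : ∀ a, ∀ x ∈ T.domain, ρ a x ∈ T.domain)

/-- The action of `A` on the domain of `T`. -/
def domRep : A →+* Module.End ℂ T.domain where
  toFun a := (ρ a).restrict (hdom a)
  map_one' := by ext; simp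
  map_mul' a b := by ext; simp
  map_zero' := by ext; simp
  map_add' a b := by ext; simp

/-- The biadditive map `(x, y) ↦ x T y`, from the domain of `T` to `N`. -/
def sandwich : A →+ A →+ (T.domain →ₗ[ℂ] N) where
  toFun x :=
    { toFun := fun y => ρ x ∘ₗ T.toFun ∘ₗ domRep ρ T hdom y
      map_zero' := by simp
      map_add' := fun y z => by rw [map_add, LinearMap.comp_add, LinearMap.comp_add] }
  map_zero' := by ext; simp
  map_add' x y := by ext; simp

theorem sandwich_apply (x y : A) (ξ : T.domain) :
    sandwich ρ T hdom x y ξ = ρ x (T (domRep ρ T hdom y ξ)) := rfl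

variable (hk : ∀ r : k, ∃ c : ℂ, ∀ x, ρ (algebraMap k A r) x = c • x)

include hk in
/-- If `k` acts on `N` through complex scalars, then `T` commutes with `k`, so that `x T y` is balanced
over `k`. -/
theorem sandwich_smul (r : k) (x y : A) :
    sandwich ρ T hdom (r • x) y = sandwich ρ T hdom x (r • y) := by
  obtain ⟨c, hc⟩ := hk r
  ext ξ
  have h : domRep ρ T hdom (r • y) ξ = c • domRep ρ T hdom y ξ := Subtype.ext (by
    change ρ (r • y) ξ = c • ρ y ξ
    rw [Algebra.smul_def, map_mul, Module.End.mul_apply, hc])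
  rw [sandwich_apply, sandwich_apply, h, LinearPMap.map_smul, (ρ x).map_smul, Algebra.smul_def r x,
    map_mul, Module.End.mul_apply, hc]

/-- The representation `a δ(b) ↦ a [T, b]` of universal one-forms as operators from the domain of
`T` to `N`. On a form `∑ xᵢ ⊗ yᵢ` it is `∑ xᵢ T yᵢ`. -/
def formOp : UnivForm k A →+ (T.domain →ₗ[ℂ] N) :=
  UnivForm.lift (sandwich ρ T hdom) (sandwich_smul ρ T hdom hk)

theorem formOp_left (a : A) (ω : UnivForm k A) (x : T.domain) :
    formOp ρ T hdom hk (UnivForm.left k a ω) x = ρ a (formOp ρ T hdom hk ω x) := by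
  have := UnivForm.lift_left (sandwich ρ T hdom) (sandwich_smul ρ T hdom hk) a
    { toFun := fun f => (ρ a).comp f, map_zero' := LinearMap.comp_zero _,
      map_add' := fun f g => LinearMap.comp_add _ _ _ } (fun x y => LinearMap.ext fun ξ => by
      simp [sandwich_apply]) ω
  exact LinearMap.congr_fun this x

theorem formOp_right (a : A) (ω : UnivForm k A) (x : T.domain) :
    formOp ρ T hdom hk (op a • ω) x = formOp ρ T hdom hk ω (domRep ρ T hdom a x) := by
  have := UnivForm.lift_right (sandwich ρ T hdom) (sandwich_smul ρ T hdom hk) a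
    { toFun := fun f => f.comp (domRep ρ T hdom a), map_zero' := LinearMap.zero_comp _,
      map_add' := fun f g => LinearMap.add_comp _ _ _ } (fun x y => LinearMap.ext fun ξ => by
      simp [sandwich_apply]) ω
  exact LinearMap.congr_fun this x

theorem formOp_δ (b : A) (x : T.domain) :
    formOp ρ T hdom hk (UnivForm.δ k b) x = T (domRep ρ T hdom b x) - ρ b (T x) := by
  rw [formOp, UnivForm.lift_δ, LinearMap.sub_apply, sandwich_apply, sandwich_apply]
  simp

variable {E : Type*} [AddCommGroup E] [Module Aᵐᵒᵖ E] (nabla : UnivConnection k A E)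

/-- `∇_T(v)`, as an operator from the domain of `T` to `E ⊗_A N`. -/
def connOp (v : E) : T.domain →ₗ[ℂ] BalTensor ρ E :=
  evalForm E (UnivForm.left k) ρ (formOp ρ T hdom hk) (formOp_left ρ T hdom hk) (nabla.toFun v)

theorem connOp_expansion {v : E} {n : ℕ} {w : Fin n → E} {a b : Fin n → A}
    (h : nabla.Expansion v w a b) (x : T.domain) :
    connOp ρ T hdom hk nabla v x =
      ∑ i, tmul ρ (w i) (ρ (a i) (T (domRep ρ T hdom (b i) x) - ρ (b i) (T x))) := by
  rw [connOp, h, map_sum, LinearMap.sum_apply]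
  refine Finset.sum_congr rfl fun i _ => ?_
  rw [evalForm_tmul, formOp_left, formOp_δ]

theorem connOp_leibniz (v : E) (a : A) (x : T.domain) :
    connOp ρ T hdom hk nabla (op a • v) x = connOp ρ T hdom hk nabla v (domRep ρ T hdom a x) +
      tmul ρ v (T (domRep ρ T hdom a x) - ρ a (T x)) := by
  have h : ∀ t : BalTensor (UnivForm.left k (A := A)) E,
      evalForm E (UnivForm.left k) ρ (formOp ρ T hdom hk) (formOp_left ρ T hdom hk) (op a • t) x =
        evalForm E (UnivForm.left k) ρ (formOp ρ T hdom hk) (formOp_left ρ T hdom hk) t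
          (domRep ρ T hdom a x) := fun t => by
    induction t using BalTensor.induction (UnivForm.left k (A := A)) with
    | h0 => simp
    | ht w ω =>
      rw [BalTensor.smul_tmul, evalForm_tmul, evalForm_tmul, formOp_right]
    | ha s t hs ht => rw [smul_add, map_add, map_add, LinearMap.add_apply, LinearMap.add_apply,
        hs, ht]
  rw [connOp, nabla.leibniz, map_add, LinearMap.add_apply, h, evalForm_tmul, formOp_δ, connOp]

/-- The operator `1 ⊗_∇ T` on `E ⊗_A Dom(T)`, given by `v ⊗ x ↦ ∇_T(v) x + v ⊗ T x`. The Leibniz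
rule for `∇` is what makes the formula balanced over `A`. -/
def twistOp : BalTensor (domRep ρ T hdom) E →ₗ[ℂ] BalTensor ρ E :=
  BalTensor.lift (domRep ρ T hdom)
    { toFun := fun v => connOp ρ T hdom hk nabla v + (tmulHom ρ v).comp T.toFun
      map_zero' := by simp [connOp]
      map_add' := fun v w => by
        rw [map_add, LinearMap.add_comp, connOp, map_add, map_add]
        exact add_add_add_comm _ _ _ _ }
    (fun v a x => by
      change connOp ρ T hdom hk nabla v (domRep ρ T hdom a x) +
          tmul ρ v (T (domRep ρ T hdom a x)) =
        connOp ρ T hdom hk nabla (op a • v) x + tmul ρ (op a • v) (T x)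
      rw [connOp_leibniz, tmul_balanced, add_assoc, ← tmulHom_apply, ← tmulHom_apply,
        ← tmulHom_apply, ← map_add, sub_add_cancel])

theorem twistOp_tmul (v : E) (x : T.domain) :
    twistOp ρ T hdom hk nabla (tmul (domRep ρ T hdom) v x) =
      connOp ρ T hdom hk nabla v x + tmul ρ v (T x) := rfl

variable (E) in
/-- The map `E ⊗_A Dom(T) → E ⊗_A N`. -/
def domIncl : BalTensor (domRep ρ T hdom) E →ₗ[ℂ] BalTensor ρ E :=
  BalTensor.map ρ (domRep ρ T hdom) E T.domain.subtype (fun _ _ => rfl)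

/-- The graph of `1 ⊗_∇ T` is the image of `E ⊗_A Dom(T)`. -/
theorem twistGraph_eq_range :
    twistGraph nabla ρ T.graph =
      LinearMap.range ((domIncl ρ T hdom E).prod (twistOp ρ T hdom hk nabla)) := by
  refine le_antisymm (Submodule.span_le.2 ?_) ?_
  · rintro _ ⟨v, n, w, a, b, x, y, z, h, hxy, hz, rfl⟩
    obtain ⟨x, rfl, rfl⟩ := T.mem_graph_iff.1 hxy
    refine ⟨tmul _ v x, Prod.ext rfl ?_⟩
    change twistOp ρ T hdom hk nabla (tmul _ v x) = _
    rw [twistOp_tmul, connOp_expansion ρ T hdom hk nabla h]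
    have hz' : ∀ i, z i = T (domRep ρ T hdom (b i) x) := fun i => by
      obtain ⟨x', h1, h2⟩ := T.mem_graph_iff.1 (hz i)
      have : x' = domRep ρ T hdom (b i) x := Subtype.ext h1
      rw [← this]; exact h2.symm
    simp only [hz']
  · rintro _ ⟨t, rfl⟩
    induction t using BalTensor.induction (domRep ρ T hdom) with
    | h0 => rw [map_zero]; exact Submodule.zero_mem _
    | ht v x =>
      obtain ⟨n, w, a, b, h⟩ := nabla.exists_expansion v
      refine Submodule.subset_span ⟨v, n, w, a, b, x, T x, fun i => T (domRep ρ T hdom (b i) x),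
        h, T.mem_graph x, fun i => T.mem_graph (domRep ρ T hdom (b i) x), Prod.ext rfl ?_⟩
      change twistOp ρ T hdom hk nabla (tmul _ v x) = _
      rw [twistOp_tmul, connOp_expansion ρ T hdom hk nabla h]
    | ha s t hs ht => rw [map_add]; exact Submodule.add_mem _ hs ht

include hdom hk in
theorem domain_toLinearPMap_twistGraph :
    (twistGraph nabla ρ T.graph).toLinearPMap.domain =
      Submodule.span ℂ {x | ∃ (v : E) (ξ : T.domain), x = tmul ρ v (ξ : N)} := by
  rw [Submodule.toLinearPMap_domain, twistGraph_eq_range ρ T hdom hk, ← LinearMap.range_comp,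
    LinearMap.fst_prod]
  refine le_antisymm ?_ (Submodule.span_le.2 ?_)
  · rintro _ ⟨t, rfl⟩
    induction t using BalTensor.induction (domRep ρ T hdom) with
    | h0 => rw [map_zero]; exact Submodule.zero_mem _
    | ht v x => exact Submodule.subset_span ⟨v, x, rfl⟩
    | ha s t hs ht => rw [map_add]; exact Submodule.add_mem _ hs ht
  · rintro _ ⟨v, ξ, rfl⟩
    exact ⟨tmul _ v ξ, rfl⟩

theorem tmul_mem_twistGraph (v : E) (x : T.domain) :
    (tmul ρ v (x : N), connOp ρ T hdom hk nabla v x + tmul ρ v (T x)) ∈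
      twistGraph nabla ρ T.graph := by
  rw [twistGraph_eq_range ρ T hdom hk]
  exact ⟨tmul _ v x, rfl⟩

include hdom hk in
/-- `1 ⊗_∇ T` is well defined. -/
theorem graph_toLinearPMap_twistGraph [Module.Finite Aᵐᵒᵖ E] [Module.Projective Aᵐᵒᵖ E] :
    (twistGraph nabla ρ T.graph).toLinearPMap.graph = twistGraph nabla ρ T.graph := by
  refine Submodule.toLinearPMap_graph_eq _ fun p hp h0 => ?_
  rw [twistGraph_eq_range ρ T hdom hk] at hp
  obtain ⟨t, rfl⟩ := hp
  have ht : t = 0 := BalTensor.map_injective ρ (domRep ρ T hdom) T.domain.subtype (fun _ _ => rfl)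
    T.domain.injective_subtype (h0.trans (map_zero (domIncl ρ T hdom E)).symm)
  rw [ht, map_zero]; rfl

end Twist

/-! ### Signs, graphs and the derivation rule for δ -/

theorem map_intUnits_smul {M P F : Type*} [AddCommGroup M] [AddCommGroup P] [FunLike F M P]
    [AddMonoidHomClass F M P] (f : F) (u : ℤˣ) (x : M) : f (u • x) = u • f x :=
  map_zsmul f (u : ℤ) x

theorem LinearPMap.apply_of_mem_graph {N P : Type*} [AddCommGroup N] [Module ℂ N]
    [AddCommGroup P] [Module ℂ P] {f : N →ₗ.[ℂ] P} {x : N} {y : P} (h : (x, y) ∈ f.graph)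
    (hx : x ∈ f.domain) : f ⟨x, hx⟩ = y := by
  obtain ⟨x', rfl, rfl⟩ := f.mem_graph_iff.1 h
  rfl

theorem UnivForm.δ_mul {k A : Type*} [Field k] [Ring A] [Algebra k A] (a b : A) :
    UnivForm.δ k (a * b) = op b • UnivForm.δ k a + UnivForm.left k a (UnivForm.δ k b) :=
  Subtype.ext (by
    change (1 : A) ⊗ₜ[k] (a * b) - (a * b) ⊗ₜ[k] (1 : A) =
      (LinearMap.mulRight k b).lTensor A ((1 : A) ⊗ₜ[k] a - a ⊗ₜ[k] (1 : A)) +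
        (LinearMap.mulLeft k a).rTensor A ((1 : A) ⊗ₜ[k] b - b ⊗ₜ[k] (1 : A))
    simp)

namespace RealSpectralTriple

variable {k A H : Type*} [RCLike k] [Algebra k ℂ] [StarModule k ℂ]
  [Ring A] [StarRing A] [Algebra k A] [StarModule k A]
  [NormedAddCommGroup H] [InnerProductSpace ℂ H] [CompleteSpace H]
  (S : RealSpectralTriple k A H) {E : Type*} [AddCommGroup E] [Module Aᵐᵒᵖ E]

/-! ### Represented one-forms -/

section Represented

theorem rep_dom (a : A) (x : H) (hx : x ∈ S.D.domain) : S.rep a x ∈ S.D.domain :=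
  S.isReal.dom a x hx

theorem rep_algebraMap (r : k) (x : H) :
    S.rep (algebraMap k A r) x = algebraMap k ℂ r • x := by
  change S.π (algebraMap k A r) x = _
  rw [S.π_algebraMap]; rfl

theorem dD_apply_rep (a : A) (x : S.D.domain) :
    S.dD a x = S.D (domRep S.rep S.D S.rep_dom a x) - S.rep a (S.D x) :=
  S.dD_apply a x

theorem dD_eq_of_eqOn (a : A) (T : H →L[ℂ] H) (h : ∀ x : S.D.domain,
    T x = S.D (domRep S.rep S.D S.rep_dom a x) - S.rep a (S.D x)) : S.dD a = T := by
  apply ContinuousLinearMap.coeFn_injective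
  refine Continuous.ext_on S.D_dense (S.dD a).continuous T.continuous fun x hx => ?_
  exact (S.dD_apply_rep a ⟨x, hx⟩).trans (h ⟨x, hx⟩).symm

theorem dD_add (a b : A) : S.dD (a + b) = S.dD a + S.dD b :=
  S.dD_eq_of_eqOn _ _ fun x => by
    rw [add_apply, dD_apply_rep, dD_apply_rep, map_add, map_add,
      LinearMap.add_apply, LinearMap.add_apply, LinearPMap.map_add]
    abel

theorem dD_algebraMap (r : k) : S.dD (algebraMap k A r) = 0 :=
  S.dD_eq_of_eqOn _ _ fun x => by
    have h : domRep S.rep S.D S.rep_dom (algebraMap k A r) x = algebraMap k ℂ r • x :=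
      Subtype.ext (S.rep_algebraMap r x)
    rw [h, rep_algebraMap, LinearPMap.map_smul, sub_self]; rfl

theorem Form.op_left (a : A) (ω : S.Form) (x : H) :
    Form.op S (Form.left S a ω) x = S.rep a (Form.op S ω x) := rfl

theorem Form.op_d (a : A) : Form.op S (Form.d S a) = S.dD a := rfl

theorem Form.d_mul (a b : A) :
    Form.d S (a * b) = MulOpposite.op b • Form.d S a + Form.left S a (Form.d S b) :=
  Subtype.ext (S.dD_mul a b)

/-- The biadditive map `(x, y) ↦ x [D, y]`. -/
def Form.mulD : A →+ A →+ S.Form where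
  toFun x :=
    { toFun := fun y => Form.left S x (Form.d S y)
      map_zero' := by
        have h : Form.d S 0 = 0 := Subtype.ext (by
          have := S.dD_algebraMap 0
          rwa [map_zero] at this)
        rw [h, map_zero]
      map_add' := fun y z => by
        have h : Form.d S (y + z) = Form.d S y + Form.d S z := Subtype.ext (S.dD_add y z)
        rw [h, map_add] }
  map_zero' := by ext y; change Form.left S 0 (Form.d S y) = 0; rw [map_zero]; rfl
  map_add' x y := by
    ext z
    change Form.left S (x + y) (Form.d S z) = Form.left S x (Form.d S z) + Form.left S y (Form.d S z)
    rw [map_add]; rfl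

theorem Form.mulD_apply (x y : A) : Form.mulD S x y = Form.left S x (Form.d S y) := rfl

theorem Form.mulD_smul (r : k) (x y : A) : Form.mulD S (r • x) y = Form.mulD S x (r • y) := by
  have h : Form.d S (algebraMap k A r) = 0 := Subtype.ext (S.dD_algebraMap r)
  rw [Form.mulD_apply, Form.mulD_apply, Algebra.smul_def, Algebra.smul_def, Form.d_mul, h,
    smul_zero, zero_add, Algebra.commutes, map_mul]
  rfl

/-- The additive map `a δ(b) ↦ a [D, b]` from universal one-forms to `Ω¹_D(A)`. -/
def Form.ofUnivAdd : UnivForm k A →+ S.Form :=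
  UnivForm.lift (Form.mulD S) (Form.mulD_smul S)

theorem Form.ofUnivAdd_left (a : A) (ω : UnivForm k A) :
    Form.ofUnivAdd S (UnivForm.left k a ω) = Form.left S a (Form.ofUnivAdd S ω) :=
  UnivForm.lift_left (Form.mulD S) (Form.mulD_smul S) a
    (Form.left S a).toAddMonoidHom (fun x y => by
      change Form.left S (a * x) _ = _
      rw [map_mul]; rfl) ω

theorem Form.ofUnivAdd_δ (b : A) : Form.ofUnivAdd S (UnivForm.δ k b) = Form.d S b := by
  have h1 : Form.d S (1 : A) = 0 := Subtype.ext (by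
    have := S.dD_algebraMap 1
    rwa [map_one] at this)
  rw [Form.ofUnivAdd, UnivForm.lift_δ, Form.mulD_apply, Form.mulD_apply, h1, map_zero, sub_zero,
    map_one]
  rfl

/-- The bimodule map `a δ(b) ↦ a [D, b]` from universal one-forms to `Ω¹_D(A)`. -/
def Form.ofUniv : UnivForm k A →ₗ[Aᵐᵒᵖ] S.Form where
  toFun := Form.ofUnivAdd S
  map_add' := map_add _
  map_smul' c ω := by
    obtain ⟨m, p, rfl⟩ := UnivForm.exists_sum ω
    simp only [Finset.smul_sum, map_sum, RingHom.id_apply]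
    refine Finset.sum_congr rfl fun j _ => ?_
    -- The right action on exact forms is determined by the left one: `δ(b) c = δ(bc) - b δ(c)`.
    have h : c • UnivForm.δ k (p j).2 = UnivForm.δ k ((p j).2 * unop c) -
        UnivForm.left k (p j).2 (UnivForm.δ k (unop c)) := by
      rw [UnivForm.δ_mul, op_unop, add_sub_cancel_right]
    rw [← map_smul, h, ofUnivAdd_left, map_sub, ofUnivAdd_δ, ofUnivAdd_left, ofUnivAdd_δ,
      Form.d_mul, op_unop, add_sub_cancel_right, ofUnivAdd_left, ofUnivAdd_δ, map_smul]

theorem Form.ofUniv_left (a : A) (ω : UnivForm k A) :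
    Form.ofUniv S (UnivForm.left k a ω) = Form.left S a (Form.ofUniv S ω) :=
  Form.ofUnivAdd_left S a ω

theorem Form.ofUniv_δ (b : A) : Form.ofUniv S (UnivForm.δ k b) = Form.d S b :=
  Form.ofUnivAdd_δ S b

/-- The connection `∇^D` obtained from a universal connection by `a δ(b) ↦ a [D, b]`. -/
def connD (nabla : UnivConnection k A E) : S.DConnection E where
  toFun := (BalTensor.map (Form.left S) (UnivForm.left k) E (Form.ofUniv S)
    (Form.ofUniv_left S)).toAddMonoidHom.comp nabla.toFun
  leibniz v a := by
    change BalTensor.map _ _ E _ (Form.ofUniv_left S) _ =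
      op a • BalTensor.map _ _ E _ (Form.ofUniv_left S) _ + _
    rw [nabla.leibniz, map_add, map_smul, BalTensor.map_tmul, Form.ofUniv_δ]

theorem connD_expansion (nabla : UnivConnection k A E) {v : E} {n : ℕ} {w : Fin n → E}
    {a b : Fin n → A} (h : nabla.Expansion v w a b) :
    (S.connD nabla).toFun v =
      ∑ i, tmul (Form.left S) (w i) (Form.left S (a i) (Form.d S (b i))) := by
  change BalTensor.map (Form.left S) (UnivForm.left k) E (Form.ofUniv S) (Form.ofUniv_left S)
    (nabla.toFun v) = _
  rw [h, map_sum]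
  refine Finset.sum_congr rfl fun i _ => ?_
  rw [BalTensor.map_tmul, Form.ofUniv_left, Form.ofUniv_δ]

theorem represents_connD (nabla : UnivConnection k A E) : S.Represents (S.connD nabla) nabla :=
  fun _ _ _ _ _ h => S.connD_expansion nabla h

end Represented

/-! ### One-forms acting on the left and on the right -/

section Actions

/-- The operator `ξ ↦ t ξ` from `H` to `E ⊗_A H` given by `t ∈ E ⊗_A Ω¹_D(A)`:
`(w ⊗ ω) ξ = w ⊗ ω ξ`. -/
def evalD : BalTensor (Form.left S) E →+ (H →ₗ[ℂ] S.LeftSpace E) :=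
  evalForm E (Form.left S) S.rep
    { toFun := fun ω => (Form.op S ω : H →ₗ[ℂ] H)
      map_zero' := rfl
      map_add' := fun _ _ => rfl } (Form.op_left S)

theorem evalD_tmul (w : E) (ω : S.Form) (ξ : H) :
    S.evalD (tmul (Form.left S) w ω) ξ = tmul S.rep w (Form.op S ω ξ) := rfl

/-- The right action of a one-form: the operator `ε J η J⁻¹`. -/
def formHat : S.Form →+ (H →ₗ[ℂ] H) where
  toFun η :=
    { toFun := fun ξ => S.ε • S.conj (Form.op S η (S.conj.symm ξ))
      map_add' := fun x y => by simp only [map_add, smul_add]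
      map_smul' := fun c x => by
        simp only [LinearEquiv.map_smulₛₗ, map_smul, RingHom.id_apply, RCLike.conj_conj,
          smul_comm S.ε c] }
  map_zero' := by
    ext ξ
    change S.ε • S.conj (0 : H) = 0
    rw [map_zero, smul_zero]
  map_add' ω η := by
    ext ξ
    change S.ε • S.conj (Form.op S ω (S.conj.symm ξ) + Form.op S η (S.conj.symm ξ)) = _
    rw [map_add, smul_add]
    rfl

theorem formHat_apply (η : S.Form) (ξ : H) :
    S.formHat η ξ = S.ε • S.conj (Form.op S η (S.conj.symm ξ)) := rfl

theorem formHat_left (a : A) (η : S.Form) (ξ : H) :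
    S.formHat (Form.left S a η) ξ = S.hat a (S.formHat η ξ) := by
  rw [formHat_apply, formHat_apply, Form.op_left, conj_rep, hat_units_smul]

/-- The operator `ξ ↦ v₁ ⊗ ξ t̄` from `H` to `E ⊗_A H ⊗_A Ē` given by `t ∈ E ⊗_A Ω¹_D(A)`:
for `t = u ⊗ η` it is `ξ ↦ v₁ ⊗ ε J η J⁻¹ ξ ⊗ ū`. -/
def evalHat (v₁ : E) : BalTensor (Form.left S) E →+ (H →ₗ[ℂ] S.Space E) :=
  evalForm E (Form.left S) (S.leftHat E)
    { toFun := fun η => (tmulHom S.rep v₁).comp (S.formHat η)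
      map_zero' := by rw [map_zero, LinearMap.comp_zero]
      map_add' := fun ω η => by rw [map_add, LinearMap.comp_add] } (fun a η ξ => by
      change tmul S.rep v₁ (S.formHat (Form.left S a η) ξ) =
        S.leftHat E a (tmul S.rep v₁ (S.formHat η ξ))
      rw [formHat_left, leftHat_tmul])

theorem evalHat_tmul (v₁ u : E) (η : S.Form) (ξ : H) :
    S.evalHat v₁ (tmul (Form.left S) u η) ξ = S.tmul₃ v₁ (S.formHat η ξ) u := rfl

theorem tmul₃_units_smul (u : ℤˣ) (v₁ v₂ : E) (ξ : H) :
    S.tmul₃ v₁ (u • ξ) v₂ = u • S.tmul₃ v₁ ξ v₂ :=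
  map_intUnits_smul ((tmulHom (S.leftHat E) v₂).comp (tmulHom S.rep v₁)) u ξ

/-- `J'` exchanges the left and the right action of one-forms. -/
theorem moritaJ_evalD (v₂ : E) (t : BalTensor (Form.left S) E) (ξ : H) :
    S.moritaJ E (tmul (S.leftHat E) v₂ (S.evalD t ξ)) =
      S.ε • S.evalHat v₂ t (S.conj ξ) := by
  induction t using BalTensor.induction (Form.left S) with
  | h0 => simp [← tmulHom_apply]
  | ht w ω =>
    rw [evalD_tmul, evalHat_tmul, formHat_apply, LinearEquiv.symm_apply_apply, tmul₃_units_smul,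
      smul_smul, Int.units_mul_self, one_smul]
    exact S.moritaJ_tmul₃ E w v₂ _
  | ha s t hs ht =>
    rw [map_add, map_add, LinearMap.add_apply, LinearMap.add_apply, smul_add, ← hs, ← ht,
      ← map_add, ← tmulHom_apply, ← tmulHom_apply, ← tmulHom_apply, map_add]

theorem moritaJ_evalHat (v₁ : E) (t : BalTensor (Form.left S) E) (ξ : H) :
    S.moritaJ E (S.evalHat v₁ t ξ) =
      S.ε • tmul (S.leftHat E) v₁ (S.evalD t (S.conj ξ)) := by
  induction t using BalTensor.induction (Form.left S) with
  | h0 => simp [← tmulHom_apply]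
  | ht w ω =>
    rw [evalD_tmul, evalHat_tmul, formHat_apply, tmul₃_units_smul, map_intUnits_smul, moritaJ_tmul₃]
    have h : S.J (S.conj (Form.op S ω (S.conj.symm ξ))) = Form.op S ω (S.conj ξ) := by
      change S.conj (S.conj (Form.op S ω (S.conj.symm ξ))) = _
      rw [conj_sq, conj_symm, map_intUnits_smul, smul_smul, Int.units_mul_self, one_smul]
    rw [h]; rfl
  | ha s t hs ht =>
    rw [map_add, map_add, LinearMap.add_apply, LinearMap.add_apply, map_add, hs, ht, ← smul_add,
      ← tmulHom_apply, ← tmulHom_apply, ← tmulHom_apply, map_add]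

end Actions

/-! ### Consequences of the first-order condition -/

section FirstOrder

variable {S} (hS : S.FirstOrder)

include hS

theorem FirstOrder.hat_dom (a : A) (x : H) (hx : x ∈ S.D.domain) : S.hat a x ∈ S.D.domain :=
  hS.dom_conj a x hx

/-- Elements of `Ω¹_D(A)` commute with `J A J⁻¹` on all of `H`, since both are bounded and `D` is
densely defined. -/
theorem FirstOrder.op_hat (ω : S.Form) (b : A) (ξ : H) :
    Form.op S ω (S.hat b ξ) = S.hat b (Form.op S ω ξ) := by
  have hd : ∀ (a : A) (ξ : H), S.dD a (S.hat b ξ) = S.hat b (S.dD a ξ) := fun a ξ => by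
    have hc : Continuous fun ξ => S.hat b ξ :=
      S.J.continuous.comp ((S.π b).continuous.comp S.J.symm.continuous)
    have h : (fun ξ => S.dD a (S.hat b ξ)) = fun ξ => S.hat b (S.dD a ξ) := by
      refine Continuous.ext_on S.D_dense ((S.dD a).continuous.comp hc)
        (hc.comp (S.dD a).continuous) fun x hx => ?_
      have h1 := S.dD_apply a ⟨x, hx⟩
      have h2 := S.dD_apply a ⟨S.hat b x, hS.hat_dom b x hx⟩
      have h3 := hS.comm a b ⟨x, hx⟩
      exact h2.trans (h3.trans (congrArg (S.hat b) h1.symm))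
    exact congrFun h ξ
  obtain ⟨T, hT⟩ := ω
  change T (S.hat b ξ) = S.hat b (T ξ)
  induction hT using AddSubgroup.closure_induction generalizing ξ with
  | mem T h =>
    obtain ⟨a, c, rfl⟩ := h
    change S.rep a (S.dD c (S.hat b ξ)) = S.hat b (S.rep a (S.dD c ξ))
    rw [hd]
    exact LinearMap.congr_fun (S.rep_hat_commute a b).eq _
  | zero => simp
  | add x y _ _ hx hy => rw [add_apply, hx, hy, ← map_add]; rfl
  | neg x _ hx => rw [neg_apply, hx, ← map_neg]; rfl

theorem FirstOrder.evalD_hat (t : BalTensor (Form.left S) E) (b : A) (ξ : H) :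
    S.evalD t (S.hat b ξ) = S.leftHat E b (S.evalD t ξ) := by
  induction t using BalTensor.induction (Form.left S) with
  | h0 => simp
  | ht w ω => rw [evalD_tmul, evalD_tmul, hS.op_hat, leftHat_tmul]
  | ha s t hs ht => rw [map_add, LinearMap.add_apply, LinearMap.add_apply, hs, ht, map_add]

/-- `[D, J b J⁻¹] = ε J [D, b] J⁻¹`. -/
theorem FirstOrder.commutator_hat (b : A) (x : S.D.domain) :
    S.D ⟨S.hat b x, hS.hat_dom b x x.2⟩ - S.hat b (S.D x) = S.formHat (Form.d S b) x := by
  have hJ : ∀ y ∈ S.D.domain, S.conj y ∈ S.D.domain := S.isReal.J_dom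
  have hD : ∀ y : S.D.domain, S.conj (S.D y) = S.ε • S.D ⟨S.conj y, hJ y y.2⟩ := S.isReal.J_D
  have hx' : S.conj.symm x ∈ S.D.domain := by
    rw [conj_symm]
    exact S.D.domain.smul_of_tower_mem (S.εJ : ℤ) (hJ x x.2)
  have h1 := S.dD_apply_rep b ⟨S.conj.symm x, hx'⟩
  have h2 : (⟨S.conj (S.conj.symm x), hJ _ hx'⟩ : S.D.domain) = x :=
    Subtype.ext (S.conj.apply_symm_apply x)
  have h3 := hD ⟨S.conj.symm x, hx'⟩
  have h4 := hD (domRep S.rep S.D S.rep_dom b ⟨S.conj.symm x, hx'⟩)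
  have h5 : (⟨S.conj (domRep S.rep S.D S.rep_dom b ⟨S.conj.symm x, hx'⟩ : S.D.domain),
      hJ _ (domRep S.rep S.D S.rep_dom b ⟨S.conj.symm x, hx'⟩).2⟩ : S.D.domain) =
      ⟨S.hat b x, hS.hat_dom b x x.2⟩ := rfl
  rw [formHat_apply, Form.op_d, h1, map_sub, conj_rep, h4, h3, h2, h5, hat_units_smul, ← smul_sub,
    smul_smul, Int.units_mul_self, one_smul]

end FirstOrder

/-! ### The fluctuated operator on elementary tensors -/

section MoritaD

variable (nabla : UnivConnection k A E)

/-- The operator `1 ⊗_∇ D` on `E ⊗_A H`. -/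
def leftD : S.LeftSpace E →ₗ.[ℂ] S.LeftSpace E := (twistGraph nabla S.rep S.D.graph).toLinearPMap

theorem rep_scalar (r : k) : ∃ c : ℂ, ∀ x, S.rep (algebraMap k A r) x = c • x :=
  ⟨_, S.rep_algebraMap r⟩

/-- Since `J` is antilinear, `r ∈ k` acts through `1 ⊗ J r J⁻¹` as the conjugate scalar. -/
theorem leftHat_scalar (r : k) : ∃ c : ℂ, ∀ x, S.leftHat E (algebraMap k A r) x = c • x := by
  refine ⟨starRingEnd ℂ (algebraMap k ℂ r), fun x => ?_⟩
  induction x using BalTensor.induction S.rep with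
  | h0 => simp
  | ht v ξ =>
    have h : S.hat (algebraMap k A r) ξ = starRingEnd ℂ (algebraMap k ℂ r) • ξ := by
      change S.conj (S.rep _ (S.conj.symm ξ)) = _
      rw [rep_algebraMap, LinearEquiv.map_smulₛₗ, LinearEquiv.apply_symm_apply]
    rw [leftHat_tmul, h, BalTensor.smul_tmul]
  | ha x y hx hy => rw [map_add, hx, hy, smul_add]

theorem connOp_rep (v : E) (x : S.D.domain) :
    connOp S.rep S.D S.rep_dom S.rep_scalar nabla v x = S.evalD ((S.connD nabla).toFun v) x := by
  obtain ⟨n, w, a, b, h⟩ := nabla.exists_expansion v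
  rw [connOp_expansion _ _ _ _ _ h, S.connD_expansion nabla h, map_sum, LinearMap.sum_apply]
  refine Finset.sum_congr rfl fun i _ => ?_
  rw [evalD_tmul, Form.op_left, Form.op_d, dD_apply_rep]

theorem leftD_domain : (S.leftD nabla).domain =
    Submodule.span ℂ {x | ∃ (v : E) (ξ : S.D.domain), x = tmul S.rep v (ξ : H)} :=
  domain_toLinearPMap_twistGraph S.rep S.D S.rep_dom S.rep_scalar nabla

theorem tmul_mem_leftD_domain (v : E) (ξ : S.D.domain) :
    tmul S.rep v (ξ : H) ∈ (S.leftD nabla).domain := by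
  rw [leftD_domain]; exact Submodule.subset_span ⟨v, ξ, rfl⟩

theorem FirstOrder.leftHat_dom {S : RealSpectralTriple k A H} (hS : S.FirstOrder) (a : A)
    (x : S.LeftSpace E) (hx : x ∈ (S.leftD nabla).domain) :
    S.leftHat E a x ∈ (S.leftD nabla).domain := by
  rw [leftD_domain] at hx
  induction hx using Submodule.span_induction with
  | mem x h =>
    obtain ⟨v, ξ, rfl⟩ := h
    rw [leftHat_tmul]
    exact S.tmul_mem_leftD_domain nabla v ⟨_, hS.hat_dom a ξ ξ.2⟩
  | zero => rw [map_zero]; exact Submodule.zero_mem _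
  | add x y _ _ hx hy => rw [map_add]; exact Submodule.add_mem _ hx hy
  | smul c x _ hx => rw [map_smul]; exact Submodule.smul_mem _ c hx

variable [Module.Finite Aᵐᵒᵖ E] [Module.Projective Aᵐᵒᵖ E]

theorem leftD_graph : (S.leftD nabla).graph = twistGraph nabla S.rep S.D.graph :=
  graph_toLinearPMap_twistGraph S.rep S.D S.rep_dom S.rep_scalar nabla

theorem leftD_tmul (v : E) (ξ : S.D.domain) (h : tmul S.rep v (ξ : H) ∈ (S.leftD nabla).domain) :
    S.leftD nabla ⟨tmul S.rep v (ξ : H), h⟩ =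
      S.evalD ((S.connD nabla).toFun v) ξ + tmul S.rep v (S.D ξ) := by
  refine LinearPMap.apply_of_mem_graph ?_ h
  rw [leftD_graph, ← connOp_rep]
  exact tmul_mem_twistGraph S.rep S.D S.rep_dom S.rep_scalar nabla v ξ

theorem moritaGraph_eq :
    S.moritaGraph nabla = twistGraph nabla (S.leftHat E) (S.leftD nabla).graph := by
  rw [leftD_graph]; rfl

variable {S} (hS : S.FirstOrder)

include hS

/-- By the first-order condition `∇^D` of the left factor commutes with `J A J⁻¹`, so that the
one-forms on the right only see the commutators `[D, J b J⁻¹]`. -/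
theorem FirstOrder.connOp_leftHat (v₁ v₂ : E) (ξ : S.D.domain) :
    connOp (S.leftHat E) (S.leftD nabla) (hS.leftHat_dom nabla) S.leftHat_scalar nabla v₂
        ⟨tmul S.rep v₁ (ξ : H), S.tmul_mem_leftD_domain nabla v₁ ξ⟩ =
      S.evalHat v₁ ((S.connD nabla).toFun v₂) ξ := by
  obtain ⟨n, w, a, b, h⟩ := nabla.exists_expansion v₂
  rw [connOp_expansion _ _ _ _ _ h, S.connD_expansion nabla h, map_sum, LinearMap.sum_apply]
  refine Finset.sum_congr rfl fun i _ => ?_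
  have h1 : domRep (S.leftHat E) (S.leftD nabla) (hS.leftHat_dom nabla) (b i)
      ⟨tmul S.rep v₁ (ξ : H), S.tmul_mem_leftD_domain nabla v₁ ξ⟩ =
      ⟨tmul S.rep v₁ (S.hat (b i) ξ),
        S.tmul_mem_leftD_domain nabla v₁ ⟨_, hS.hat_dom (b i) ξ ξ.2⟩⟩ := rfl
  have h2 := S.leftD_tmul nabla v₁ ⟨_, hS.hat_dom (b i) ξ ξ.2⟩
    (S.tmul_mem_leftD_domain nabla v₁ ⟨_, hS.hat_dom (b i) ξ ξ.2⟩)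
  rw [evalHat_tmul, formHat_left, ← hS.commutator_hat, h1]
  -- `h2` matches only up to unfolding the coercion of a subtype.
  erw [h2]
  rw [leftD_tmul, hS.evalD_hat, map_add (S.leftHat E (b i)), leftHat_tmul,
    add_sub_add_left_eq_sub, ← tmulHom_apply S.rep v₁, ← tmulHom_apply S.rep v₁, ← map_sub,
    tmulHom_apply, leftHat_tmul]
  rfl

theorem FirstOrder.moritaD_graph : (S.moritaD nabla).graph = S.moritaGraph nabla := by
  rw [moritaD, moritaGraph_eq]
  exact graph_toLinearPMap_twistGraph (S.leftHat E) (S.leftD nabla) (hS.leftHat_dom nabla)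
    S.leftHat_scalar nabla

theorem FirstOrder.moritaD_domain : (S.moritaD nabla).domain =
    Submodule.span ℂ {x | ∃ (v₁ v₂ : E) (ξ : S.D.domain), x = S.tmul₃ v₁ (ξ : H) v₂} := by
  have h := domain_toLinearPMap_twistGraph (S.leftHat E) (S.leftD nabla) (hS.leftHat_dom nabla)
    S.leftHat_scalar nabla
  rw [moritaD, moritaGraph_eq, h]
  refine le_antisymm (Submodule.span_le.2 ?_) (Submodule.span_mono ?_)
  · rintro _ ⟨v₂, ⟨x, hx⟩, rfl⟩
    change tmulHom (S.leftHat E) v₂ x ∈ Submodule.span ℂ _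
    rw [leftD_domain] at hx
    induction hx using Submodule.span_induction with
    | mem x h =>
      obtain ⟨v₁, ξ, rfl⟩ := h
      exact Submodule.subset_span ⟨v₁, v₂, ξ, rfl⟩
    | zero => rw [map_zero]; exact Submodule.zero_mem _
    | add x y _ _ hx hy => rw [map_add]; exact Submodule.add_mem _ hx hy
    | smul c x _ hx => rw [map_smul]; exact Submodule.smul_mem _ c hx
  · rintro _ ⟨v₁, v₂, ξ, rfl⟩
    exact ⟨v₂, ⟨_, S.tmul_mem_leftD_domain nabla v₁ ξ⟩, rfl⟩

theorem FirstOrder.tmul₃_mem_domain (v₁ v₂ : E) (ξ : H) (hξ : ξ ∈ S.D.domain) :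
    S.tmul₃ v₁ ξ v₂ ∈ (S.moritaD nabla).domain := by
  rw [hS.moritaD_domain]; exact Submodule.subset_span ⟨v₁, v₂, ⟨ξ, hξ⟩, rfl⟩

/-- The inner fluctuation formula for `D'` on elementary tensors. -/
theorem FirstOrder.moritaD_tmul₃ (v₁ v₂ : E) (ξ : S.D.domain)
    (h : S.tmul₃ v₁ (ξ : H) v₂ ∈ (S.moritaD nabla).domain) :
    S.moritaD nabla ⟨S.tmul₃ v₁ (ξ : H) v₂, h⟩ =
      tmul (S.leftHat E) v₂ (S.evalD ((S.connD nabla).toFun v₁) ξ) + S.tmul₃ v₁ (S.D ξ) v₂ +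
        S.evalHat v₁ ((S.connD nabla).toFun v₂) ξ := by
  refine LinearPMap.apply_of_mem_graph ?_ h
  rw [hS.moritaD_graph, moritaGraph_eq]
  convert! tmul_mem_twistGraph (S.leftHat E) (S.leftD nabla) (hS.leftHat_dom nabla)
    S.leftHat_scalar nabla v₂ ⟨tmul S.rep v₁ (ξ : H), S.tmul_mem_leftD_domain nabla v₁ ξ⟩ using 2
  rw [hS.connOp_leftHat, leftD_tmul, add_comm]
  congr 1
  exact (map_add (tmulHom (S.leftHat E) v₂) _ _).symm

/-- To prove an additive property on the domain of `D'` it suffices to check elementary tensors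
`v₁ ⊗ ξ ⊗ v̄₂` with `ξ` in the domain of `D`. -/
theorem FirstOrder.domain_induction {p : (S.moritaD nabla).domain → Prop} (h0 : p 0)
    (ht : ∀ (v₁ v₂ : E) (ξ : S.D.domain),
      p ⟨S.tmul₃ v₁ ξ v₂, hS.tmul₃_mem_domain nabla v₁ v₂ ξ ξ.2⟩)
    (ha : ∀ x y, p x → p y → p (x + y)) (x : (S.moritaD nabla).domain) : p x := by
  obtain ⟨x, hx⟩ := x
  have hx' := hx
  rw [hS.moritaD_domain] at hx'
  -- Multiples of elementary tensors are elementary tensors.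
  suffices h : ∀ c : ℂ, ∃ h : c • x ∈ (S.moritaD nabla).domain, p ⟨c • x, h⟩ by
    obtain ⟨h, hp⟩ := h 1
    simpa using hp
  clear hx
  induction hx' using Submodule.span_induction with
  | mem x h =>
    obtain ⟨v₁, v₂, ξ, rfl⟩ := h
    intro c
    have hc : c • S.tmul₃ v₁ (ξ : H) v₂ = S.tmul₃ v₁ ((c • ξ : S.D.domain) : H) v₂ :=
      ((((tmulHom (S.leftHat E) v₂).comp (tmulHom S.rep v₁))).map_smul c (ξ : H)).symm
    simp only [hc]
    exact ⟨hS.tmul₃_mem_domain nabla v₁ v₂ _ (c • ξ).2, ht v₁ v₂ (c • ξ)⟩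
  | zero =>
    intro c
    simp only [smul_zero]
    exact ⟨Submodule.zero_mem _, h0⟩
  | add x y _ _ hx hy =>
    intro c
    obtain ⟨h1, h1'⟩ := hx c
    obtain ⟨h2, h2'⟩ := hy c
    simp only [smul_add]
    exact ⟨Submodule.add_mem _ h1 h2, ha _ _ h1' h2'⟩
  | smul d x _ hx =>
    intro c
    simp only [smul_smul]
    exact hx (c * d)

end MoritaD

/-! ### The Morita-equivalent triple -/

section Triple

theorem moritaRep_tmul₃ (φ : Module.End Aᵐᵒᵖ E) (v₁ v₂ : E) (ξ : H) :
    S.moritaRep E φ (S.tmul₃ v₁ ξ v₂) = S.tmul₃ (φ v₁) ξ v₂ := rfl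

theorem moritaJ_symm_tmul₃ (v₁ v₂ : E) (ξ : H) :
    (S.moritaJ E).symm (S.tmul₃ v₁ ξ v₂) = S.tmul₃ v₂ (S.conj.symm ξ) v₁ := rfl

/-- `J' End_A(E) J'⁻¹` acts on the last factor. -/
theorem conjRep_moritaRep_eq (ψ : Module.End Aᵐᵒᵖ E) :
    conjRep (S.moritaJ E) (S.moritaRep E) ψ = endAction (S.leftHat E) E ψ := by
  refine LinearMap.ext fun x => ?_
  induction x using Space.induction S E with
  | h0 => rw [map_zero, map_zero]
  | ht v₁ ξ v₂ =>
    rw [conjRep_apply, moritaJ_symm_tmul₃, moritaRep_tmul₃, moritaJ_tmul₃]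
    exact congrArg (fun η => S.tmul₃ v₁ η (ψ v₂)) (S.conj.apply_symm_apply ξ)
  | ha x y hx hy => rw [map_add, map_add, hx, hy]

variable {S} (hS : S.FirstOrder) (nabla : UnivConnection k A E)
  [Module.Finite Aᵐᵒᵖ E] [Module.Projective Aᵐᵒᵖ E]

include hS

theorem FirstOrder.moritaRep_dom (φ : Module.End Aᵐᵒᵖ E) (x : S.Space E)
    (hx : x ∈ (S.moritaD nabla).domain) : S.moritaRep E φ x ∈ (S.moritaD nabla).domain := by
  refine hS.domain_induction nabla (p := fun x => S.moritaRep E φ x ∈ (S.moritaD nabla).domain)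
    ?_ (fun v₁ v₂ ξ => ?_) (fun x y hx hy => ?_) ⟨x, hx⟩
  · rw [Submodule.coe_zero, map_zero]; exact Submodule.zero_mem _
  · exact hS.tmul₃_mem_domain nabla (φ v₁) v₂ ξ ξ.2
  · rw [Submodule.coe_add, map_add]; exact Submodule.add_mem _ hx hy

theorem FirstOrder.moritaJ_dom (x : S.Space E) (hx : x ∈ (S.moritaD nabla).domain) :
    S.moritaJ E x ∈ (S.moritaD nabla).domain := by
  refine hS.domain_induction nabla (p := fun x => S.moritaJ E x ∈ (S.moritaD nabla).domain)
    ?_ (fun v₁ v₂ ξ => ?_) (fun x y hx hy => ?_) ⟨x, hx⟩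
  · rw [Submodule.coe_zero, map_zero]; exact Submodule.zero_mem _
  · exact hS.tmul₃_mem_domain nabla v₂ v₁ _ (S.isReal.J_dom ξ ξ.2)
  · rw [Submodule.coe_add, map_add]; exact Submodule.add_mem _ hx hy

theorem FirstOrder.endAction_dom (ψ : Module.End Aᵐᵒᵖ E) (x : S.Space E)
    (hx : x ∈ (S.moritaD nabla).domain) :
    endAction (S.leftHat E) E ψ x ∈ (S.moritaD nabla).domain := by
  refine hS.domain_induction nabla
    (p := fun x => endAction (S.leftHat E) E ψ x ∈ (S.moritaD nabla).domain)
    ?_ (fun v₁ v₂ ξ => ?_) (fun x y hx hy => ?_) ⟨x, hx⟩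
  · rw [Submodule.coe_zero, map_zero]; exact Submodule.zero_mem _
  · exact hS.tmul₃_mem_domain nabla v₁ (ψ v₂) ξ ξ.2
  · rw [Submodule.coe_add, map_add]; exact Submodule.add_mem _ hx hy

theorem FirstOrder.moritaJ_moritaD (x : (S.moritaD nabla).domain) :
    S.moritaJ E (S.moritaD nabla x) =
      S.ε • S.moritaD nabla ⟨S.moritaJ E x, hS.moritaJ_dom nabla x x.2⟩ := by
  induction x using hS.domain_induction nabla with
  | h0 =>
    have h : (⟨S.moritaJ E (0 : (S.moritaD nabla).domain), hS.moritaJ_dom nabla _ (0 :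
        (S.moritaD nabla).domain).2⟩ : (S.moritaD nabla).domain) = 0 :=
      Subtype.ext (map_zero (S.moritaJ E))
    rw [h, LinearPMap.map_zero, map_zero, smul_zero]
  | ht v₁ v₂ ξ =>
    have h : S.moritaD nabla ⟨S.moritaJ E (S.tmul₃ v₁ ξ v₂),
        hS.moritaJ_dom nabla _ (hS.tmul₃_mem_domain nabla v₁ v₂ ξ ξ.2)⟩ = _ :=
      hS.moritaD_tmul₃ nabla v₂ v₁ ⟨S.conj ξ, S.isReal.J_dom ξ ξ.2⟩
        (hS.tmul₃_mem_domain nabla v₂ v₁ _ (S.isReal.J_dom ξ ξ.2))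
    have hD : S.J (S.D ξ) = S.ε • S.D ⟨S.conj ξ, S.isReal.J_dom ξ ξ.2⟩ := S.isReal.J_D ξ
    rw [h, hS.moritaD_tmul₃, map_add, map_add, moritaJ_evalD, moritaJ_evalHat, moritaJ_tmul₃, hD,
      tmul₃_units_smul, smul_add, smul_add]
    abel
  | ha x y hx hy =>
    have h : (⟨S.moritaJ E (x + y : (S.moritaD nabla).domain), hS.moritaJ_dom nabla _
        (x + y).2⟩ : (S.moritaD nabla).domain) = ⟨S.moritaJ E x, hS.moritaJ_dom nabla x x.2⟩ +
          ⟨S.moritaJ E y, hS.moritaJ_dom nabla y y.2⟩ :=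
      Subtype.ext (map_add (S.moritaJ E) (x : S.Space E) y)
    rw [h, LinearPMap.map_add, LinearPMap.map_add, map_add, hx, hy, smul_add]

theorem FirstOrder.isRealStructure_morita :
    IsRealStructure (S.moritaRep E) (S.moritaD nabla) (S.moritaJ E) S.εJ S.ε where
  dom := hS.moritaRep_dom nabla
  J_sq x := by
    induction x using Space.induction S E with
    | h0 => simp
    | ht v₁ ξ v₂ =>
      rw [moritaJ_tmul₃, moritaJ_tmul₃, ← tmul₃_units_smul]
      exact congrArg (fun η => S.tmul₃ v₁ η v₂) (S.conj_sq ξ)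
    | ha x y hx hy => rw [map_add, map_add, hx, hy, smul_add]
  J_dom := hS.moritaJ_dom nabla
  J_D := hS.moritaJ_moritaD nabla
  commutant φ ψ := by
    rw [conjRep_moritaRep_eq]
    refine LinearMap.ext fun x => ?_
    induction x using Space.induction S E with
    | h0 => rw [map_zero, map_zero]
    | ht v₁ ξ v₂ => rfl
    | ha x y hx hy => rw [map_add, map_add, hx, hy]

/-- `[D', φ]` only involves the first two tensor factors. -/
theorem FirstOrder.commutator_tmul₃ (φ : Module.End Aᵐᵒᵖ E) (v₁ v₂ : E) (ξ : S.D.domain)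
    (h : S.tmul₃ v₁ (ξ : H) v₂ ∈ (S.moritaD nabla).domain) :
    commutator (S.moritaD nabla) (S.moritaRep E φ) (hS.moritaRep_dom nabla φ)
        ⟨S.tmul₃ v₁ (ξ : H) v₂, h⟩ =
      tmul (S.leftHat E) v₂ (S.evalD ((S.connD nabla).toFun (φ v₁)) ξ -
        endAction S.rep E φ (S.evalD ((S.connD nabla).toFun v₁) ξ)) := by
  have hφ : ∀ t : BalTensor (Form.left S) E,
      S.moritaRep E φ (S.evalHat v₁ t ξ) = S.evalHat (φ v₁) t ξ := fun t => by
    induction t using BalTensor.induction (Form.left S) with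
    | h0 => simp
    | ht w η => rfl
    | ha s t hs ht => simp only [map_add, LinearMap.add_apply, hs, ht]
  have h1 : S.moritaD nabla ⟨S.moritaRep E φ (S.tmul₃ v₁ (ξ : H) v₂),
      hS.moritaRep_dom nabla φ _ h⟩ = _ := hS.moritaD_tmul₃ nabla (φ v₁) v₂ ξ
        (hS.tmul₃_mem_domain nabla _ _ ξ ξ.2)
  have h2 : ∀ y : S.LeftSpace E, S.moritaRep E φ (tmul (S.leftHat E) v₂ y) =
    tmul (S.leftHat E) v₂ (endAction S.rep E φ y) := fun y => rfl
  rw [commutator_apply, h1, hS.moritaD_tmul₃, map_add, map_add, hφ, moritaRep_tmul₃, h2,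
    add_sub_add_right_eq_sub, add_sub_add_right_eq_sub]
  exact (map_sub (tmulHom (S.leftHat E) v₂) _ _).symm

theorem FirstOrder.firstOrderCondition_morita :
    FirstOrderCondition (S.moritaRep E) (S.moritaD nabla) (S.moritaJ E) where
  dom := hS.moritaRep_dom nabla
  dom_conj ψ := by rw [conjRep_moritaRep_eq]; exact hS.endAction_dom nabla ψ
  comm φ ψ x := by
    simp only [conjRep_moritaRep_eq]
    induction x using hS.domain_induction nabla with
    | h0 =>
      have h : (⟨endAction (S.leftHat E) E ψ (0 : (S.moritaD nabla).domain),
          hS.endAction_dom nabla ψ _ (0 : (S.moritaD nabla).domain).2⟩ :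
          (S.moritaD nabla).domain) = 0 := Subtype.ext (map_zero (endAction (S.leftHat E) E ψ))
      rw [h, map_zero, map_zero]
    | ht v₁ v₂ ξ =>
      have h := hS.commutator_tmul₃ nabla φ v₁ (ψ v₂) ξ (hS.tmul₃_mem_domain nabla _ _ ξ ξ.2)
      refine h.trans ?_
      rw [hS.commutator_tmul₃]
      rfl
    | ha x y hx hy =>
      have h : (⟨endAction (S.leftHat E) E ψ (x + y : (S.moritaD nabla).domain),
          hS.endAction_dom nabla ψ _ (x + y).2⟩ : (S.moritaD nabla).domain) =
          ⟨endAction (S.leftHat E) E ψ x, hS.endAction_dom nabla ψ x x.2⟩ +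
            ⟨endAction (S.leftHat E) E ψ y, hS.endAction_dom nabla ψ y y.2⟩ :=
        Subtype.ext (map_add (endAction (S.leftHat E) E ψ) (x : S.Space E) y)
      rw [h, map_add, map_add, map_add, hx, hy]

/-- All expansions of `∇^D v₁` and `∇^D v₂` give the same value, since `evalD` and `evalHat` are
defined on the tensor product `E ⊗_A Ω¹_D(A)`. -/
theorem FirstOrder.graph_eq_usualGraph :
    (S.moritaD nabla).graph = S.usualGraph (S.connD nabla) := by
  have hle : S.usualGraph (S.connD nabla) ≤ (S.moritaD nabla).graph := by
    refine Submodule.span_le.2 ?_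
    rintro _ ⟨v₁, v₂, ξ, m, n, w, ω, u, η, h₁, h₂, rfl⟩
    refine (S.moritaD nabla).mem_graph_iff.2
      ⟨⟨_, hS.tmul₃_mem_domain nabla v₁ v₂ ξ ξ.2⟩, rfl, ?_⟩
    rw [hS.moritaD_tmul₃, h₁, h₂, map_sum, map_sum, LinearMap.sum_apply, LinearMap.sum_apply,
      ← tmulHom_apply (S.leftHat E) v₂, map_sum]
    rfl
  refine le_antisymm ?_ hle
  rintro ⟨x, y⟩ hxy
  obtain ⟨x, rfl, rfl⟩ := (S.moritaD nabla).mem_graph_iff.1 hxy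
  clear hxy
  induction x using hS.domain_induction nabla with
  | h0 => rw [LinearPMap.map_zero]; exact Submodule.zero_mem _
  | ht v₁ v₂ ξ =>
    have hex : ∀ ω : S.Form, ∃ (m : ℕ) (i : Fin m → S.Form), ω = ∑ j, i j :=
      fun ω => ⟨1, fun _ => ω, by rw [Fin.sum_univ_one]⟩
    obtain ⟨m, w, ω, h₁⟩ := BalTensor.exists_sum (Form.left S) (fun ω : S.Form => ω) hex
      ((S.connD nabla).toFun v₁)
    obtain ⟨n, u, η, h₂⟩ := BalTensor.exists_sum (Form.left S) (fun ω : S.Form => ω) hex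
      ((S.connD nabla).toFun v₂)
    have hp : (S.tmul₃ v₁ (ξ : H) v₂, _) ∈ S.usualGraph (S.connD nabla) :=
      Submodule.subset_span ⟨v₁, v₂, ξ, m, n, w, ω, u, η, h₁, h₂, rfl⟩
    have hy := LinearPMap.apply_of_mem_graph (hle hp) (hS.tmul₃_mem_domain nabla v₁ v₂ ξ ξ.2)
    rw [hy]
    exact hp
  | ha x y hx hy =>
    rw [LinearPMap.map_add]
    exact Submodule.add_mem _ hx hy

end Triple

end RealSpectralTriple

end NCG

end

theorem mainTheorem5 {k A H E : Type*} [RCLike k] [Algebra k ℂ] [StarModule k ℂ]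
    [Ring A] [StarRing A] [Algebra k A] [StarModule k A]
    [NormedAddCommGroup H] [InnerProductSpace ℂ H] [CompleteSpace H]
    (S : NCG.RealSpectralTriple k A H)
    [AddCommGroup E] [Module Aᵐᵒᵖ E] [Module.Finite Aᵐᵒᵖ E] [Module.Projective Aᵐᵒᵖ E]
    (nabla : NCG.UnivConnection k A E) (hS : S.FirstOrder) :
    (S.moritaD nabla).graph = S.moritaGraph nabla ∧
    (S.moritaD nabla).domain =
      Submodule.span ℂ {x | ∃ (v₁ v₂ : E) (ξ : S.D.domain), x = S.tmul₃ v₁ (ξ : H) v₂} ∧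
    NCG.IsRealStructure (S.moritaRep E) (S.moritaD nabla) (S.moritaJ E) S.εJ S.ε ∧
    NCG.FirstOrderCondition (S.moritaRep E) (S.moritaD nabla) (S.moritaJ E) ∧
    ∃ nablaD : S.DConnection E, S.Represents nablaD nabla ∧
      (S.moritaD nabla).graph = S.usualGraph nablaD := by
  exact ⟨hS.moritaD_graph nabla, hS.moritaD_domain nabla, hS.isRealStructure_morita nabla,
    hS.firstOrderCondition_morita nabla, S.connD nabla, S.represents_connD nabla,
    hS.graph_eq_usualGraph nabla⟩
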